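/- For $k>0$ and $x,y\in\mathbb R^3$, $x\ne y$, let $\Phi_k(x,y)=\dfrac{e^{\mathrm i k|x-y|}}{4\pi|x-y|}$ be the outgoing fundamental solution of $-\Delta-k^2$, and let $$(\mathcal R_k\varphi)(x)=\int_{\mathbb R^3}\Phi_k(x,y)\,\varphi(y)\,dy$$ for functions $\varphi$ for which this integral is well-defined (absolutely convergent) for almost every $x\in\mathbb R^3$. For $s,\delta\in\mathbb R$, with $\langle x\rangle=(1+|x|^2)^{1/2}$, let $$\|f\|_{H^s_\delta(\mathbb R^3)}=\|\langle\cdot\rangle^{\delta}(I-\Delta)^{s/2}f\|_{L^2(\mathbb R^3)},\qquad H^s_\delta(\mathbb R^3)=\{f\in\mathscr S'(\mathbb R^3):\ \|f\|_{H^s_\delta(\mathbb R^3)}<\infty\}.$$ Let $0<s<1/2$ and $\epsilon>0$. Then there is a constant $C_{\epsilon,s}>0$, depending only on $\epsilon$ and $s$, such that for every $k>2$ there is exactly one bounded linear operator from $H^{-s}_{1/2+\epsilon}(\mathbb R^3)$ to $H^{s}_{-1/2-\epsilon}(\mathbb R^3)$ which coincides with the integral operator $\mathcal R_k$ on every function in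 $H^{-s}_{1/2+\epsilon}(\mathbb R^3)$ for which the integral is well-defined almost everywhere; and this operator, again denoted by $\mathcal R_k$, satisfies $$\|\mathcal R_k\varphi\|_{H^{s}_{-1/2-\epsilon}(\mathbb R^3)}\le C_{\epsilon,s}\,k^{-(1-2s)}\,\|\varphi\|_{H^{-s}_{1/2+\epsilon}(\mathbb R^3)}\qquad\text{for all }\varphi\in H^{-s}_{1/2+\epsilon}(\mathbb R^3).$$ -/

import Mathlib

open MeasureTheory TemperedDistribution
open scoped SchwartzMap

noncomputable section

/-- Three-dimensional Euclidean space. -/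
abbrev R3 : Type := EuclideanSpace ℝ (Fin 3)

/-- The power `⟨x⟩ ^ δ` of the Japanese bracket `⟨x⟩ = (1 + |x|²)^(1/2)`. -/
def bracketPow (δ : ℝ) (x : R3) : ℂ := (((1 + ‖x‖ ^ 2) ^ (δ / 2) : ℝ) : ℂ)

theorem bracketPow_hasTemperateGrowth (δ : ℝ) : (bracketPow δ).HasTemperateGrowth := by
  unfold bracketPow
  fun_prop

theorem bracketPow_mul_neg (δ : ℝ) (x : R3) : bracketPow δ x * bracketPow (-δ) x = 1 := by
  unfold bracketPow
  rw [← Complex.ofReal_mul, ← Real.rpow_add (by positivity)]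
  simp [neg_div]

/-- The Fourier symbol of `(I - Δ)^(s/2)`. The Fourier transform of Mathlib is
`∫ e^(-2πi x·ξ) φ(x) dx`, under which `-Δ` has the symbol `|2πξ|²`. -/
def laplaceSymbol (s : ℝ) (ξ : R3) : ℂ := bracketPow s ((2 * Real.pi) • ξ)

theorem laplaceSymbol_hasTemperateGrowth (s : ℝ) : (laplaceSymbol s).HasTemperateGrowth := by
  have h : (fun ξ : R3 => (2 * Real.pi) • ξ).HasTemperateGrowth := by fun_prop
  exact (bracketPow_hasTemperateGrowth s).comp h

/-- The operator `(I - Δ)^(s/2)` on tempered distributions on `ℝ³`. -/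
def fracBessel (s : ℝ) : 𝓢'(R3, ℂ) →L[ℂ] 𝓢'(R3, ℂ) :=
  fourierMultiplierCLM ℂ (laplaceSymbol s)

/-- The operator `f ↦ ⟨x⟩^δ (I - Δ)^(s/2) f` on tempered distributions on `ℝ³`. -/
def weightedBessel (s δ : ℝ) : 𝓢'(R3, ℂ) →L[ℂ] 𝓢'(R3, ℂ) :=
  smulLeftCLM ℂ (bracketPow δ) ∘L fracBessel s

theorem weightedBessel_injective (s δ : ℝ) : Function.Injective (weightedBessel s δ) := by
  have h1 : Function.LeftInverse (smulLeftCLM ℂ (bracketPow (-δ)))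
      (smulLeftCLM ℂ (bracketPow δ) : 𝓢'(R3, ℂ) →L[ℂ] 𝓢'(R3, ℂ)) := by
    intro f
    rw [smulLeftCLM_smulLeftCLM_apply (bracketPow_hasTemperateGrowth _)
      (bracketPow_hasTemperateGrowth _)]
    have : bracketPow δ * bracketPow (-δ) = fun _ : R3 => (1 : ℂ) :=
      funext (bracketPow_mul_neg δ)
    rw [this]
    simp
  have h2 : Function.LeftInverse (fracBessel (-s)) (fracBessel s) := by
    intro f
    unfold fracBessel
    rw [fourierMultiplierCLM_fourierMultiplierCLM_apply (laplaceSymbol_hasTemperateGrowth _)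
      (laplaceSymbol_hasTemperateGrowth _)]
    have : laplaceSymbol s * laplaceSymbol (-s) = fun _ : R3 => (1 : ℂ) :=
      funext fun ξ => bracketPow_mul_neg s _
    rw [this]
    simp
  exact h1.injective.comp h2.injective

/-- The weighted Sobolev space `H^s_δ(ℝ³)`: all tempered distributions `f` such that
`⟨x⟩^δ (I - Δ)^(s/2) f` belongs to `L²(ℝ³)`. It carries the norm
`‖f‖ = ‖⟨x⟩^δ (I - Δ)^(s/2) f‖_{L²}`. -/
structure WeightedSobolev (s δ : ℝ) where
  toDistribution : 𝓢'(R3, ℂ)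
  mem : ∃ g : Lp ℂ 2 (volume : Measure R3), weightedBessel s δ toDistribution = g

namespace WeightedSobolev

variable {s δ : ℝ}

theorem toDistribution_injective :
    Function.Injective (toDistribution : WeightedSobolev s δ → 𝓢'(R3, ℂ)) := by
  rintro ⟨f, hf⟩ ⟨g, hg⟩ h
  cases h
  rfl

instance : Zero (WeightedSobolev s δ) where
  zero := ⟨0, 0, by rw [← Lp.toTemperedDistributionCLM_apply, map_zero, map_zero]⟩

instance : Add (WeightedSobolev s δ) where
  add f g := ⟨f.toDistribution + g.toDistribution, by
    obtain ⟨a, ha⟩ := f.mem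
    obtain ⟨b, hb⟩ := g.mem
    refine ⟨a + b, ?_⟩
    rw [map_add, ha, hb]
    exact (map_add (Lp.toTemperedDistributionCLM ℂ volume 2) a b).symm⟩

instance : Neg (WeightedSobolev s δ) where
  neg f := ⟨-f.toDistribution, by
    obtain ⟨a, ha⟩ := f.mem
    refine ⟨-a, ?_⟩
    rw [map_neg, ha]
    exact (map_neg (Lp.toTemperedDistributionCLM ℂ volume 2) a).symm⟩

instance : Sub (WeightedSobolev s δ) where
  sub f g := ⟨f.toDistribution - g.toDistribution, by
    obtain ⟨a, ha⟩ := f.mem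
    obtain ⟨b, hb⟩ := g.mem
    refine ⟨a - b, ?_⟩
    rw [map_sub, ha, hb]
    exact (map_sub (Lp.toTemperedDistributionCLM ℂ volume 2) a b).symm⟩

theorem smul_mem {R : Type*} [SMul R ℂ] [SMul R 𝓢'(R3, ℂ)] [IsScalarTower R ℂ 𝓢'(R3, ℂ)]
    (c : R) (f : WeightedSobolev s δ) :
    ∃ g : Lp ℂ 2 (volume : Measure R3), weightedBessel s δ (c • f.toDistribution) = g := by
  obtain ⟨a, ha⟩ := f.mem
  refine ⟨(c • (1 : ℂ)) • a, ?_⟩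
  rw [← one_smul ℂ f.toDistribution, ← smul_assoc, map_smul, ha]
  exact (map_smul (Lp.toTemperedDistributionCLM ℂ volume 2) _ a).symm

instance : SMul ℕ (WeightedSobolev s δ) where
  smul c f := ⟨c • f.toDistribution, smul_mem c f⟩

instance : SMul ℤ (WeightedSobolev s δ) where
  smul c f := ⟨c • f.toDistribution, smul_mem c f⟩

instance : SMul ℂ (WeightedSobolev s δ) where
  smul c f := ⟨c • f.toDistribution, smul_mem c f⟩

instance : AddCommGroup (WeightedSobolev s δ) :=
  toDistribution_injective.addCommGroup _ rfl (fun _ _ => rfl) (fun _ => rfl) (fun _ _ => rfl)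
    (fun _ _ => rfl) (fun _ _ => rfl)

/-- The inclusion of `H^s_δ(ℝ³)` into the tempered distributions, as an additive map. -/
def toDistributionHom : WeightedSobolev s δ →+ 𝓢'(R3, ℂ) where
  toFun := toDistribution
  map_zero' := rfl
  map_add' _ _ := rfl

instance : Module ℂ (WeightedSobolev s δ) :=
  toDistribution_injective.module ℂ toDistributionHom (fun _ _ => rfl)

/-- The function `⟨x⟩^δ (I - Δ)^(s/2) f` as an element of `L²(ℝ³)`. -/
def repr (f : WeightedSobolev s δ) : Lp ℂ 2 (volume : Measure R3) := f.mem.choose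

theorem repr_spec (f : WeightedSobolev s δ) :
    weightedBessel s δ f.toDistribution = (f.repr : 𝓢'(R3, ℂ)) := f.mem.choose_spec

theorem lp_toDistribution_injective : Function.Injective
    (Lp.toTemperedDistributionCLM ℂ (volume : Measure R3) 2) :=
  LinearMap.ker_eq_bot.mp Lp.ker_toTemperedDistributionCLM_eq_bot

/-- `f ↦ ⟨x⟩^δ (I - Δ)^(s/2) f` as a linear map from `H^s_δ(ℝ³)` to `L²(ℝ³)`. -/
def reprHom : WeightedSobolev s δ →ₗ[ℂ] Lp ℂ 2 (volume : Measure R3) where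
  toFun := repr
  map_add' f g := by
    apply lp_toDistribution_injective
    rw [map_add]
    simp only [Lp.toTemperedDistributionCLM_apply, ← repr_spec]
    exact map_add (weightedBessel s δ) _ _
  map_smul' c f := by
    apply lp_toDistribution_injective
    rw [map_smul]
    simp only [Lp.toTemperedDistributionCLM_apply, ← repr_spec]
    exact map_smul (weightedBessel s δ) _ _

theorem reprHom_injective : Function.Injective (reprHom : WeightedSobolev s δ →ₗ[ℂ] _) := by
  intro f g h
  apply toDistribution_injective
  apply weightedBessel_injective s δ
  rw [repr_spec, repr_spec]
  exact congrArg _ h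

instance : NormedAddCommGroup (WeightedSobolev s δ) :=
  NormedAddCommGroup.induced _ _ reprHom reprHom_injective

instance : NormedSpace ℂ (WeightedSobolev s δ) :=
  NormedSpace.induced ℂ _ _ reprHom

theorem norm_def (f : WeightedSobolev s δ) : ‖f‖ = ‖f.repr‖ := rfl

end WeightedSobolev

/-- The outgoing fundamental solution `Φ_k(x, y) = e^(ik|x-y|) / (4π|x-y|)` of `-Δ - k²`. -/
def outgoingKernel (k : ℝ) (x y : R3) : ℂ :=
  Complex.exp (Complex.I * k * ‖x - y‖) / (4 * Real.pi * ‖x - y‖)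

/-- The integral `∫ Φ_k(x, y) φ(y) dy`. -/
def resolventIntegral (k : ℝ) (φ : R3 → ℂ) (x : R3) : ℂ :=
  ∫ y, outgoingKernel k x y * φ y

/-- The integral `∫ Φ_k(x, y) φ(y) dy` converges absolutely for almost every `x`. -/
def ResolventIntegrable (k : ℝ) (φ : R3 → ℂ) : Prop :=
  ∀ᵐ x : R3, Integrable (fun y => outgoingKernel k x y * φ y)

/-- The tempered distribution `u` is the function `f`. -/
def IsGivenBy (u : 𝓢'(R3, ℂ)) (f : R3 → ℂ) : Prop :=
  ∀ ψ : 𝓢(R3, ℂ), Integrable (fun x => ψ x * f x) ∧ u ψ = ∫ x, ψ x * f x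

/-- A bounded operator `T : H^s_δ → H^t_γ` extends the resolvent `R_k`: on every function `f`
in `H^s_δ` for which `∫ Φ_k(x, y) f(y) dy` is well-defined for almost every `x`, it is given
by that integral. -/
def ExtendsResolvent (k : ℝ) {s δ t γ : ℝ}
    (T : WeightedSobolev s δ →L[ℂ] WeightedSobolev t γ) : Prop :=
  ∀ (φ : WeightedSobolev s δ) (f : R3 → ℂ), IsGivenBy φ.toDistribution f →
    ResolventIntegrable k f → IsGivenBy (T φ).toDistribution (resolventIntegral k f)

end

/-!
The operator is the weak limit of `(-Δ - z²)⁻¹` as `z = k + iη` tends to `k` from the upper half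
plane, and the point is a bound that is uniform in `η`. Pairing `-Δu - z²u = f` with the derivative
of `u` along the bounded vector field `(2 - ⟨x⟩^(-e)) x / ⟨x⟩` (a Morawetz multiplier, whose
Jacobian is at least `e ⟨x⟩^(-1-e)`) controls `k u` and `∇u` in `L²` with weight `⟨x⟩^(-(1+e)/2)` by
`f` in `L²` with weight `⟨x⟩^((1+e)/2)`; the terms that `η` produces are absorbed by means of the
energy identity.

To pass to `(I - Δ)^(s/2) (-Δ - z²)⁻¹ (I - Δ)^(s/2)`, freeze `(1 + |ξ|²)^s` at `|ξ| = k`, its value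
where the resolvent is singular: the frozen part has size `k^(2s) k⁻¹`, and the difference is a
bounded Fourier multiplier of size `k^(2s-2)`. Green's representation formula for `η > 0` and
dominated convergence identify the limit with the integral operator, and uniqueness holds because
Schwartz functions are dense.
-/

noncomputable section

open LineDeriv Laplacian FourierTransform Filter Topology
open scoped InnerProductSpace

section RadialMultipliers

variable {E F : Type*} [NormedAddCommGroup E] [InnerProductSpace ℝ E]

/-- The temperate function `g` has gradient `g'(x) x` at every `x`, as radial functions do. -/
structure HasRadialGradient (g g' : E → ℝ) : Prop where
  hasTemperateGrowth : g.HasTemperateGrowth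
  hasTemperateGrowth' : g'.HasTemperateGrowth
  hasFDerivAt (x : E) : HasFDerivAt g (g' x • innerSL ℝ x) x

namespace HasRadialGradient

variable {g g' h h' : E → ℝ}

theorem const (c : ℝ) : HasRadialGradient (fun _ : E => c) 0 where
  hasTemperateGrowth := .const c
  hasTemperateGrowth' := .const 0
  hasFDerivAt x := by simpa using hasFDerivAt_const c x

theorem add (hg : HasRadialGradient g g') (hh : HasRadialGradient h h') :
    HasRadialGradient (g + h) (g' + h') where
  hasTemperateGrowth := hg.hasTemperateGrowth.add hh.hasTemperateGrowth
  hasTemperateGrowth' := hg.hasTemperateGrowth'.add hh.hasTemperateGrowth'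
  hasFDerivAt x := by
    rw [Pi.add_apply, add_smul]
    exact (hg.hasFDerivAt x).add (hh.hasFDerivAt x)

theorem const_smul (c : ℝ) (hg : HasRadialGradient g g') :
    HasRadialGradient (c • g) (c • g') where
  hasTemperateGrowth := (Function.HasTemperateGrowth.const c).mul hg.hasTemperateGrowth
  hasTemperateGrowth' := (Function.HasTemperateGrowth.const c).mul hg.hasTemperateGrowth'
  hasFDerivAt x := by
    rw [Pi.smul_apply, smul_assoc]
    exact (hg.hasFDerivAt x).const_smul c

theorem norm_sq_mul (hg : HasRadialGradient g g') :
    HasRadialGradient (fun x => ‖x‖ ^ 2 * g x) (fun x => 2 * g x + ‖x‖ ^ 2 * g' x) where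
  hasTemperateGrowth := by
    have := hg.hasTemperateGrowth
    fun_prop
  hasTemperateGrowth' := by
    have := hg.hasTemperateGrowth
    have := hg.hasTemperateGrowth'
    fun_prop
  hasFDerivAt x := by
    convert! (hasStrictFDerivAt_norm_sq x).hasFDerivAt.mul (hg.hasFDerivAt x) using 1
    ext m
    simp
    ring

theorem hasLineDerivAt (hg : HasRadialGradient g g') (m x : E) :
    HasLineDerivAt ℝ g (⟪m, x⟫_ℝ * g' x) x m := by
  convert! (hg.hasFDerivAt x).hasLineDerivAt m using 1
  simp [real_inner_comm, mul_comm]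

theorem hasLineDerivAt_inner_mul (hg : HasRadialGradient g g') (m x : E) :
    HasLineDerivAt ℝ (fun x => ⟪m, x⟫_ℝ * g x) (‖m‖ ^ 2 * g x + ⟪m, x⟫_ℝ ^ 2 * g' x) x m := by
  convert! (((innerSL ℝ m).hasFDerivAt.mul (hg.hasFDerivAt x)).hasLineDerivAt m) using 1
  simp [real_inner_comm m x]
  ring

end HasRadialGradient

/-- The divergence of the vector field `h(x) x` when `h` has the radial gradient `h'(x) x`.
In particular `radialDiv w' w''` is the Laplacian of `w`. -/
def radialDiv (h h' : E → ℝ) (x : E) : ℝ := Module.finrank ℝ E * h x + ‖x‖ ^ 2 * h' x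

theorem HasRadialGradient.radialDiv {h h' h'' : E → ℝ} (hh : HasRadialGradient h h')
    (hh' : HasRadialGradient h' h'') :
    HasRadialGradient (radialDiv h h') (radialDiv h' h'' + (2 : ℝ) • h') := by
  convert! (hh.const_smul (Module.finrank ℝ E : ℝ)).add hh'.norm_sq_mul using 1
  ext x
  simp only [_root_.radialDiv, Pi.add_apply, Pi.smul_apply, smul_eq_mul]
  ring

variable [NormedAddCommGroup F] [NormedSpace ℝ F]

/-- The Euler operator `x · ∇` on Schwartz functions. -/
def euler (u : 𝓢(E, F)) : 𝓢(E, F) :=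
  SchwartzMap.bilinLeftCLM (ContinuousLinearMap.id ℝ (E →L[ℝ] F)) .id'
    (SchwartzMap.fderivCLM ℝ E F u)

theorem euler_apply (u : 𝓢(E, F)) (x : E) : euler u x = fderiv ℝ u x x := rfl

theorem sum_inner_smul_lineDeriv {ι : Type*} [Fintype ι] (b : OrthonormalBasis ι ℝ E)
    (u : 𝓢(E, F)) (x : E) : ∑ i, ⟪b i, x⟫_ℝ • (∂_{b i} u) x = euler u x := by
  simp only [SchwartzMap.lineDerivOp_apply_eq_fderiv, ← map_smul, ← map_sum, b.sum_repr',
    euler_apply]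

theorem lineDeriv_smulLeftCLM {W W' : E → ℝ} (hW : W.HasTemperateGrowth) {m : E}
    (h : ∀ x, HasLineDerivAt ℝ W (W' x) x m) (u : 𝓢(E, F)) (x : E) :
    (∂_{m} (SchwartzMap.smulLeftCLM F W u)) x = W x • (∂_{m} u) x + W' x • u x := by
  have hWu : HasLineDerivAt ℝ (SchwartzMap.smulLeftCLM F W u)
      (W x • (∂_{m} u) x + W' x • u x) x m := by
    rw [SchwartzMap.smulLeftCLM_apply hW, SchwartzMap.lineDerivOp_apply_eq_fderiv]
    have hu := (u.hasFDerivAt x).hasLineDerivAt m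
    have hw := h x
    unfold HasLineDerivAt at hu hw ⊢
    convert! hw.smul hu using 1
    simp
  rw [SchwartzMap.lineDerivOp_apply_eq_fderiv]
  exact (SchwartzMap.hasFDerivAt _ x).hasLineDerivAt m |>.unique hWu

theorem lineDeriv_euler (m : E) (u : 𝓢(E, F)) : ∂_{m} (euler u) = ∂_{m} u + euler (∂_{m} u) := by
  have hdu (x : E) : DifferentiableAt ℝ (fderiv ℝ u) x :=
    (((u.smooth 2).fderiv_right (m := 1) (by norm_num)).differentiable (by simp)) x
  have hm : ⇑(∂_{m} u : 𝓢(E, F)) = fun x => fderiv ℝ u x m :=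
    funext fun x => SchwartzMap.lineDerivOp_apply_eq_fderiv _ _ _
  have heuler : ⇑(euler u) = fun x => fderiv ℝ u x x := rfl
  ext x
  have symm := ((u.smooth 2).contDiffAt (x := x)).isSymmSndFDerivAt (by simp)
  rw [add_apply, euler_apply, SchwartzMap.lineDerivOp_apply_eq_fderiv, heuler, hm,
    fderiv_clm_apply (hdu x) (by fun_prop), fderiv_clm_apply (hdu x) (by fun_prop)]
  simp [symm.eq m x]

end RadialMultipliers

section EnergyIdentities

variable {E F : Type*} [NormedAddCommGroup E] [InnerProductSpace ℝ E] [FiniteDimensional ℝ E]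
  [MeasurableSpace E] [BorelSpace E] [NormedAddCommGroup F] [InnerProductSpace ℝ F]

/-- The pairing `∫ W ⟪a, b⟫` of two Schwartz functions against a real weight, the pairing used in
all the energy identities. The real inner product on `F` makes taking real parts superfluous when
`F = ℂ`. -/
def weightedInner (W : E → ℝ) (a b : 𝓢(E, F)) : ℝ := ∫ x, W x * ⟪a x, b x⟫_ℝ

theorem integrable_weight_mul_inner {W : E → ℝ} (hW : W.HasTemperateGrowth) (a b : 𝓢(E, F)) :
    Integrable (fun x => W x * ⟪a x, b x⟫_ℝ) := by
  refine (SchwartzMap.pairing (innerSL ℝ) (SchwartzMap.smulLeftCLM F W a) b).integrable.congr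
    (.of_forall fun x => ?_)
  rw [SchwartzMap.pairing_apply_apply, SchwartzMap.smulLeftCLM_apply_apply hW]
  exact real_inner_smul_left _ _ _

theorem weightedInner_comm (W : E → ℝ) (a b : 𝓢(E, F)) :
    weightedInner W a b = weightedInner W b a := by
  simp only [weightedInner, real_inner_comm]

theorem weightedInner_add_left {W : E → ℝ} (hW : W.HasTemperateGrowth) (a a' b : 𝓢(E, F)) :
    weightedInner W (a + a') b = weightedInner W a b + weightedInner W a' b := by
  simp only [weightedInner, add_apply, inner_add_left, mul_add]
  exact integral_add (integrable_weight_mul_inner hW _ _) (integrable_weight_mul_inner hW _ _)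

theorem weightedInner_neg_left (W : E → ℝ) (a b : 𝓢(E, F)) :
    weightedInner W (-a) b = -weightedInner W a b := by
  simp only [weightedInner, neg_apply, inner_neg_left, mul_neg, integral_neg]

theorem weightedInner_smul_left (W : E → ℝ) (c : ℝ) (a b : 𝓢(E, F)) :
    weightedInner W (c • a) b = c * weightedInner W a b := by
  simp only [weightedInner, smul_apply, real_inner_smul_left, mul_left_comm,
    integral_const_mul]

theorem weightedInner_sum_left {ι : Type*} (s : Finset ι) {W : E → ℝ}
    (hW : W.HasTemperateGrowth) (a : ι → 𝓢(E, F)) (b : 𝓢(E, F)) :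
    weightedInner W (∑ i ∈ s, a i) b = ∑ i ∈ s, weightedInner W (a i) b := by
  simp only [weightedInner, sum_apply, sum_inner, Finset.mul_sum]
  exact integral_finsetSum _ fun i _ => integrable_weight_mul_inner hW _ _

theorem weightedInner_lineDeriv_left {W W' : E → ℝ} (hW : W.HasTemperateGrowth)
    (hW' : W'.HasTemperateGrowth) {m : E} (h : ∀ x, HasLineDerivAt ℝ W (W' x) x m)
    (a b : 𝓢(E, F)) :
    weightedInner W (∂_{m} a) b = -weightedInner W a (∂_{m} b) - weightedInner W' a b := by
  have parts : ∫ x, ⟪W x • a x, (∂_{m} b) x⟫_ℝ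
      = -∫ x, ⟪W x • (∂_{m} a) x + W' x • a x, b x⟫_ℝ := by
    have := SchwartzMap.integral_bilinear_lineDerivOp_right_eq_neg_left (μ := volume)
      (SchwartzMap.smulLeftCLM F W a) b (innerSL ℝ) m
    simp only [lineDeriv_smulLeftCLM hW h, SchwartzMap.smulLeftCLM_apply_apply hW] at this
    exact this
  simp only [inner_add_left, real_inner_smul_left] at parts
  rw [integral_add (integrable_weight_mul_inner hW _ _) (integrable_weight_mul_inner hW' _ _)]
    at parts
  simp only [weightedInner]
  linarith

theorem sum_weightedInner_inner_mul {ι : Type*} [Fintype ι] (b : OrthonormalBasis ι ℝ E)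
    {h : E → ℝ} (hh : h.HasTemperateGrowth) (u v : 𝓢(E, F)) :
    ∑ i, weightedInner (fun x => ⟪b i, x⟫_ℝ * h x) (∂_{b i} u) v = weightedInner h (euler u) v := by
  simp only [weightedInner]
  rw [← integral_finsetSum _ fun i _ => integrable_weight_mul_inner (by fun_prop) _ _]
  refine integral_congr_ae (.of_forall fun x => ?_)
  simp only [← sum_inner_smul_lineDeriv b u x, sum_inner, real_inner_smul_left, Finset.mul_sum]
  exact Finset.sum_congr rfl fun i _ => by ring

theorem weightedInner_euler_left {h h' : E → ℝ} (hh : HasRadialGradient h h') (u v : 𝓢(E, F)) :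
    weightedInner h (euler u) v
      = -weightedInner h u (euler v) - weightedInner (radialDiv h h') u v := by
  let b := stdOrthonormalBasis ℝ E
  have ht := hh.hasTemperateGrowth
  have ht' := hh.hasTemperateGrowth'
  have parts i := weightedInner_lineDeriv_left (by fun_prop) (by fun_prop)
    (hh.hasLineDerivAt_inner_mul (b i)) u v
  have hdiv : ∑ i, weightedInner (fun x => ‖b i‖ ^ 2 * h x + ⟪b i, x⟫_ℝ ^ 2 * h' x) u v
      = weightedInner (radialDiv h h') u v := by
    simp only [weightedInner]
    rw [← integral_finsetSum _ fun i _ => integrable_weight_mul_inner (by fun_prop) _ _]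
    refine integral_congr_ae (.of_forall fun x => ?_)
    simp only [← Finset.sum_mul, Finset.sum_add_distrib, b.norm_eq_one, b.sum_sq_inner_right]
    simp [radialDiv]
  rw [← sum_weightedInner_inner_mul b ht, weightedInner_comm h u,
    ← sum_weightedInner_inner_mul b ht v u, ← hdiv]
  simp only [parts, weightedInner_comm _ u, Finset.sum_sub_distrib, Finset.sum_neg_distrib]

/-- The weighted Dirichlet form `∫ w |∇u|²`. -/
def dirichlet (w : E → ℝ) (u : 𝓢(E, F)) : ℝ :=
  ∑ i, weightedInner w (∂_{stdOrthonormalBasis ℝ E i} u) (∂_{stdOrthonormalBasis ℝ E i} u)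

theorem weightedInner_laplacian_left {w w' : E → ℝ} (hw : HasRadialGradient w w')
    (u v : 𝓢(E, F)) :
    weightedInner w (Δ u) v = -∑ i, weightedInner w (∂_{stdOrthonormalBasis ℝ E i} u)
      (∂_{stdOrthonormalBasis ℝ E i} v) - weightedInner w' (euler u) v := by
  let b := stdOrthonormalBasis ℝ E
  have ht := hw.hasTemperateGrowth
  have ht' := hw.hasTemperateGrowth'
  have parts i := weightedInner_lineDeriv_left ht (by fun_prop) (hw.hasLineDerivAt (b i))
    (∂_{b i} u) v
  rw [SchwartzMap.laplacian_eq_sum b, weightedInner_sum_left _ ht]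
  simp only [parts, Finset.sum_sub_distrib, Finset.sum_neg_distrib,
    sum_weightedInner_inner_mul b ht']
  rfl

theorem energy_identity {w w' w'' : E → ℝ} (hw : HasRadialGradient w w')
    (hw' : HasRadialGradient w' w'') (u : 𝓢(E, F)) :
    weightedInner w (Δ u) u = -dirichlet w u + 1 / 2 * weightedInner (radialDiv w' w'') u u := by
  have transport := weightedInner_euler_left hw' u u
  rw [weightedInner_comm w' u] at transport
  rw [weightedInner_laplacian_left hw, dirichlet]
  linarith

theorem momentum_identity {h h' : E → ℝ} (hh : HasRadialGradient h h') (u : 𝓢(E, F)) :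
    weightedInner h (Δ u) (euler u) = 1 / 2 * dirichlet (radialDiv h h') u - dirichlet h u
      - weightedInner h' (euler u) (euler u) := by
  let b := stdOrthonormalBasis ℝ E
  have term i : weightedInner h (∂_{b i} u) (∂_{b i} (euler u)) =
      weightedInner h (∂_{b i} u) (∂_{b i} u)
        - 1 / 2 * weightedInner (radialDiv h h') (∂_{b i} u) (∂_{b i} u) := by
    have transport := weightedInner_euler_left hh (∂_{b i} u) (∂_{b i} u)
    rw [weightedInner_comm h (∂_{b i} u) (euler _)] at transport
    rw [weightedInner_comm, lineDeriv_euler, weightedInner_add_left hh.hasTemperateGrowth]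
    linarith
  rw [weightedInner_laplacian_left hh, Finset.sum_congr rfl fun i _ => term i,
    Finset.sum_sub_distrib, ← Finset.mul_sum]
  simp only [dirichlet, b]
  ring

theorem morawetz_identity {h h' h'' h''' : E → ℝ} (hh : HasRadialGradient h h')
    (hh' : HasRadialGradient h' h'') (hh'' : HasRadialGradient h'' h''') (u : 𝓢(E, F)) :
    dirichlet h u + weightedInner h' (euler u) (euler u) =
      -weightedInner h (Δ u) (euler u) - 1 / 2 * weightedInner (radialDiv h h') (Δ u) u
        + 1 / 4 * weightedInner (radialDiv (radialDiv h' h'' + (2 : ℝ) • h')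
          (radialDiv h'' h''' + (2 : ℝ) • h'' + (2 : ℝ) • h'')) u u := by
  have energy := energy_identity (hh.radialDiv hh')
    ((hh'.radialDiv hh'').add (hh'.const_smul 2)) u
  have momentum := momentum_identity hh u
  linarith

end EnergyIdentities

section WeightedBounds

theorem abs_integral_le_half_add {α : Type*} [MeasurableSpace α] {μ : Measure α} {c p q : α → ℝ}
    (hp : Integrable p μ) (hq : Integrable q μ) (hp₀ : ∀ x, 0 ≤ p x) (hq₀ : ∀ x, 0 ≤ q x)
    (h : ∀ x, c x ^ 2 ≤ p x * q x) : |∫ x, c x ∂μ| ≤ (∫ x, p x ∂μ + ∫ x, q x ∂μ) / 2 := by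
  rw [← integral_add hp hq, ← integral_div, ← Real.norm_eq_abs]
  refine norm_integral_le_of_norm_le ((hp.add hq).div_const 2) (.of_forall fun x => ?_)
  rw [Real.norm_eq_abs]
  refine abs_le_of_sq_le_sq (by nlinarith [h x, sq_nonneg (p x - q x)]) ?_
  linarith [hp₀ x, hq₀ x]

variable {E F : Type*} [NormedAddCommGroup E] [InnerProductSpace ℝ E]
  [NormedAddCommGroup F]

theorem norm_euler_sq_le [NormedSpace ℝ F] {ι : Type*} [Fintype ι] (b : OrthonormalBasis ι ℝ E)
    (u : 𝓢(E, F)) (x : E) : ‖euler u x‖ ^ 2 ≤ ‖x‖ ^ 2 * ∑ i, ‖(∂_{b i} u) x‖ ^ 2 := by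
  have hnorm : ‖euler u x‖ ≤ ∑ i, |⟪b i, x⟫_ℝ| * ‖(∂_{b i} u) x‖ := by
    rw [← sum_inner_smul_lineDeriv b u x]
    refine (norm_sum_le _ _).trans_eq (Finset.sum_congr rfl fun i _ => ?_)
    rw [norm_smul, Real.norm_eq_abs]
  refine (pow_le_pow_left₀ (norm_nonneg _) hnorm 2).trans ?_
  have cauchySchwarz := Finset.sum_mul_sq_le_sq_mul_sq Finset.univ (fun i => |⟪b i, x⟫_ℝ|)
    (fun i => ‖(∂_{b i} u) x‖)
  simpa only [sq_abs, b.sum_sq_inner_right] using cauchySchwarz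

variable [InnerProductSpace ℝ F] [FiniteDimensional ℝ E] [MeasurableSpace E] [BorelSpace E]
  {W w w' : E → ℝ}

theorem weightedInner_self (w : E → ℝ) (a : 𝓢(E, F)) :
    weightedInner w a a = ∫ x, w x * ‖a x‖ ^ 2 := by
  simp only [weightedInner, real_inner_self_eq_norm_sq]

theorem integrable_weight_mul_norm_sq (hw : w.HasTemperateGrowth) (a : 𝓢(E, F)) :
    Integrable fun x => w x * ‖a x‖ ^ 2 := by
  simpa only [real_inner_self_eq_norm_sq] using integrable_weight_mul_inner hw a a

theorem weightedInner_self_nonneg (hw : ∀ x, 0 ≤ w x) (a : 𝓢(E, F)) :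
    0 ≤ weightedInner w a a := by
  rw [weightedInner_self]
  exact integral_nonneg fun x => mul_nonneg (hw x) (sq_nonneg _)

theorem weightedInner_self_mono (hw : w.HasTemperateGrowth) (hw' : w'.HasTemperateGrowth)
    (h : ∀ x, w x ≤ w' x) (a : 𝓢(E, F)) : weightedInner w a a ≤ weightedInner w' a a := by
  simp only [weightedInner_self]
  exact integral_mono (integrable_weight_mul_norm_sq hw a) (integrable_weight_mul_norm_sq hw' a)
    fun x => mul_le_mul_of_nonneg_right (h x) (sq_nonneg _)

theorem weightedInner_const_smul (c : ℝ) (w : E → ℝ) (a b : 𝓢(E, F)) :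
    weightedInner (c • w) a b = c * weightedInner w a b := by
  simp only [weightedInner, Pi.smul_apply, smul_eq_mul, mul_assoc, integral_const_mul]

theorem dirichlet_const_smul (c : ℝ) (w : E → ℝ) (u : 𝓢(E, F)) :
    dirichlet (c • w) u = c * dirichlet w u := by
  simp only [dirichlet, weightedInner_const_smul, Finset.mul_sum]

theorem integrable_weight_mul_sum_norm_sq (hw : w.HasTemperateGrowth) (u : 𝓢(E, F)) :
    Integrable fun x => w x * ∑ i, ‖(∂_{stdOrthonormalBasis ℝ E i} u) x‖ ^ 2 := by
  simp only [Finset.mul_sum]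
  exact integrable_finsetSum _ fun i _ => integrable_weight_mul_norm_sq hw _

theorem dirichlet_eq_integral (hw : w.HasTemperateGrowth) (u : 𝓢(E, F)) :
    dirichlet w u = ∫ x, w x * ∑ i, ‖(∂_{stdOrthonormalBasis ℝ E i} u) x‖ ^ 2 := by
  simp only [dirichlet, weightedInner_self, Finset.mul_sum]
  exact (integral_finsetSum _ fun i _ => integrable_weight_mul_norm_sq hw _).symm

theorem abs_weightedInner_le (hw : w.HasTemperateGrowth) (hw' : w'.HasTemperateGrowth)
    (hw₀ : ∀ x, 0 ≤ w x) (hw₀' : ∀ x, 0 ≤ w' x) (hW : ∀ x, W x ^ 2 ≤ w x * w' x)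
    (a b : 𝓢(E, F)) :
    |weightedInner W a b| ≤ (weightedInner w a a + weightedInner w' b b) / 2 := by
  simp only [weightedInner_self]
  refine abs_integral_le_half_add (integrable_weight_mul_norm_sq hw a)
    (integrable_weight_mul_norm_sq hw' b) (fun x => mul_nonneg (hw₀ x) (sq_nonneg _))
    (fun x => mul_nonneg (hw₀' x) (sq_nonneg _)) fun x => ?_
  calc (W x * ⟪a x, b x⟫_ℝ) ^ 2 = W x ^ 2 * ⟪a x, b x⟫_ℝ ^ 2 := mul_pow _ _ _
    _ ≤ (w x * w' x) * (‖a x‖ * ‖b x‖) ^ 2 :=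
      mul_le_mul (hW x) (sq_le_sq' (neg_le_of_abs_le (abs_real_inner_le_norm _ _))
        (real_inner_le_norm _ _)) (sq_nonneg _) (mul_nonneg (hw₀ x) (hw₀' x))
    _ = _ := by ring

theorem abs_weightedInner_euler_le (hw : w.HasTemperateGrowth) (hw' : w'.HasTemperateGrowth)
    (hw₀ : ∀ x, 0 ≤ w x) (hw₀' : ∀ x, 0 ≤ w' x) (hW : ∀ x, W x ^ 2 * ‖x‖ ^ 2 ≤ w x * w' x)
    (a u : 𝓢(E, F)) :
    |weightedInner W a (euler u)| ≤ (weightedInner w a a + dirichlet w' u) / 2 := by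
  rw [dirichlet_eq_integral hw', weightedInner_self]
  refine abs_integral_le_half_add (integrable_weight_mul_norm_sq hw a)
    (integrable_weight_mul_sum_norm_sq hw' u) (fun x => mul_nonneg (hw₀ x) (sq_nonneg _))
    (fun x => mul_nonneg (hw₀' x) (Finset.sum_nonneg fun i _ => sq_nonneg _)) fun x => ?_
  set S := ∑ i, ‖(∂_{stdOrthonormalBasis ℝ E i} u) x‖ ^ 2
  have hS : 0 ≤ S := Finset.sum_nonneg fun i _ => sq_nonneg _
  calc (W x * ⟪a x, euler u x⟫_ℝ) ^ 2 = W x ^ 2 * ⟪a x, euler u x⟫_ℝ ^ 2 := mul_pow _ _ _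
    _ ≤ W x ^ 2 * (‖a x‖ * ‖euler u x‖) ^ 2 := by
      gcongr W x ^ 2 * ?_
      exact sq_le_sq' (neg_le_of_abs_le (abs_real_inner_le_norm _ _)) (real_inner_le_norm _ _)
    _ ≤ W x ^ 2 * (‖a x‖ ^ 2 * (‖x‖ ^ 2 * S)) := by
      rw [mul_pow]
      gcongr
      exact norm_euler_sq_le _ u x
    _ = (W x ^ 2 * ‖x‖ ^ 2) * (‖a x‖ ^ 2 * S) := by ring
    _ ≤ (w x * w' x) * (‖a x‖ ^ 2 * S) :=
      mul_le_mul_of_nonneg_right (hW x) (mul_nonneg (sq_nonneg _) hS)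
    _ = _ := by ring

end WeightedBounds

section Bracket

variable {E : Type*} [NormedAddCommGroup E]

/-- The power `⟨x⟩ ^ p` of the Japanese bracket, real-valued and on any normed space. On `R3` it is
the real number underlying `bracketPow p x`. -/
def bracket (p : ℝ) (x : E) : ℝ := (1 + ‖x‖ ^ 2) ^ (p / 2)

theorem bracket_pos (p : ℝ) (x : E) : 0 < bracket p x := by unfold bracket; positivity

theorem bracket_zero (x : E) : bracket 0 x = 1 := by simp [bracket]

theorem bracket_two (x : E) : bracket 2 x = 1 + ‖x‖ ^ 2 := by simp [bracket]

theorem bracket_add (p q : ℝ) (x : E) : bracket (p + q) x = bracket p x * bracket q x := by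
  rw [bracket, add_div, Real.rpow_add (by positivity), bracket, bracket]

theorem bracket_neg (p : ℝ) (x : E) : bracket (-p) x = (bracket p x)⁻¹ := by
  rw [bracket, neg_div, Real.rpow_neg (by positivity), bracket]

theorem bracket_mono {p q : ℝ} (h : p ≤ q) (x : E) : bracket p x ≤ bracket q x :=
  Real.rpow_le_rpow_of_exponent_le (by linarith [sq_nonneg ‖x‖]) (by linarith)

theorem bracket_le_one {p : ℝ} (h : p ≤ 0) (x : E) : bracket p x ≤ 1 :=
  (bracket_mono h x).trans_eq (bracket_zero x)

theorem norm_sq_mul_bracket_neg_one_sq (x : E) :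
    ‖x‖ ^ 2 * bracket (-1) x ^ 2 = 1 - bracket (-1) x ^ 2 := by
  have h : bracket 2 x * (bracket (-1) x * bracket (-1) x) = 1 := by
    rw [← bracket_add, ← bracket_add]
    norm_num [bracket_zero]
  rw [bracket_two] at h
  linear_combination h

theorem norm_mul_bracket_neg_one_le (x : E) : ‖x‖ * bracket (-1) x ≤ 1 := by
  refine le_of_sq_le_sq ?_ zero_le_one
  linarith [mul_pow ‖x‖ (bracket (-1) x) 2, norm_sq_mul_bracket_neg_one_sq x,
    sq_nonneg (bracket (-1) x)]

/-- The `n`-th function in the chain of radial gradients that starts at `⟨x⟩ ^ p`. -/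
def bracketDeriv (p : ℝ) (n : ℕ) : E → ℝ :=
  (∏ j ∈ Finset.range n, (p - 2 * j)) • bracket (p - 2 * n)

theorem bracketDeriv_apply (p : ℝ) (n : ℕ) (x : E) : bracketDeriv p n x =
    (∏ j ∈ Finset.range n, (p - 2 * j)) * (bracket p x * bracket (-1) x ^ (2 * n)) := by
  have hpow : bracket (-1) x ^ (2 * n) = bracket (-(2 * n)) x := by
    rw [bracket, bracket, ← Real.rpow_mul_natCast (by positivity)]
    push_cast
    ring_nf
  rw [hpow, ← bracket_add, ← sub_eq_add_neg, bracketDeriv, Pi.smul_apply, smul_eq_mul]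

variable [InnerProductSpace ℝ E]

@[fun_prop]
theorem bracket_hasTemperateGrowth (p : ℝ) : (bracket p : E → ℝ).HasTemperateGrowth := by
  unfold bracket
  fun_prop

theorem hasRadialGradient_bracket (p : ℝ) :
    HasRadialGradient (bracket p : E → ℝ) (p • bracket (p - 2)) where
  hasTemperateGrowth := by fun_prop
  hasTemperateGrowth' := (Function.HasTemperateGrowth.const p).mul (by fun_prop)
  hasFDerivAt x := by
    have h : HasFDerivAt (fun x : E => 1 + ‖x‖ ^ 2) (2 • innerSL ℝ x) x :=
      (hasStrictFDerivAt_norm_sq x).hasFDerivAt.const_add 1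
    convert! h.rpow_const (p := p / 2) (Or.inl (by positivity)) using 1
    ext m
    simp [bracket, sub_div]
    ring

theorem hasRadialGradient_bracketDeriv (p : ℝ) (n : ℕ) :
    HasRadialGradient (bracketDeriv p n : E → ℝ) (bracketDeriv p (n + 1)) := by
  convert! (hasRadialGradient_bracket (E := E) (p - 2 * n)).const_smul
    (∏ j ∈ Finset.range n, (p - 2 * j)) using 1
  rw [bracketDeriv, Finset.prod_range_succ, smul_smul]
  push_cast
  ring_nf

end Bracket

section Helmholtz

variable {E : Type*} [NormedAddCommGroup E] [InnerProductSpace ℝ E] [FiniteDimensional ℝ E]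

/-- The Helmholtz operator `-Δ - z²` on Schwartz functions. -/
def helmholtz (z : ℂ) (u : 𝓢(E, ℂ)) : 𝓢(E, ℂ) := -(Δ u) - z ^ 2 • u

variable [MeasurableSpace E] [BorelSpace E] {w w' w'' : E → ℝ}

theorem weightedInner_I_smul_self (w : E → ℝ) (u : 𝓢(E, ℂ)) :
    weightedInner w (Complex.I • u) u = 0 := by
  simp [weightedInner, Complex.inner, mul_comm]

theorem weightedInner_I_smul_I_smul (w : E → ℝ) (u v : 𝓢(E, ℂ)) :
    weightedInner w (Complex.I • u) (Complex.I • v) = weightedInner w u v := by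
  simp [weightedInner, Complex.inner]

theorem weightedInner_helmholtz_left (hw : w.HasTemperateGrowth) (z : ℂ) (u v : 𝓢(E, ℂ)) :
    weightedInner w (helmholtz z u) v = -weightedInner w (Δ u) v
      - (z ^ 2).re * weightedInner w u v - (z ^ 2).im * weightedInner w (Complex.I • u) v := by
  have hz : z ^ 2 • u = (z ^ 2).re • u + (z ^ 2).im • (Complex.I • u) := by
    ext x
    simp only [smul_apply, add_apply, smul_eq_mul, Complex.real_smul]
    linear_combination (-u x) * Complex.re_add_im (z ^ 2)
  rw [helmholtz, hz, sub_eq_add_neg, weightedInner_add_left hw, weightedInner_neg_left,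
    weightedInner_neg_left, weightedInner_add_left hw, weightedInner_smul_left,
    weightedInner_smul_left]
  ring

theorem dirichlet_eq_helmholtz (hw : HasRadialGradient w w') (hw' : HasRadialGradient w' w'')
    (z : ℂ) (u : 𝓢(E, ℂ)) :
    dirichlet w u = (z ^ 2).re * weightedInner w u u + weightedInner w (helmholtz z u) u
      + 1 / 2 * weightedInner (radialDiv w' w'') u u := by
  rw [weightedInner_helmholtz_left hw.hasTemperateGrowth, weightedInner_I_smul_self,
    energy_identity hw hw']
  ring

theorem im_sq_mul_weightedInner_eq (z : ℂ) (u : 𝓢(E, ℂ)) :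
    (z ^ 2).im * weightedInner (fun _ => 1) u u =
      -weightedInner (fun _ => 1) (helmholtz z u) (Complex.I • u) := by
  have flux : weightedInner (fun _ => 1) (Δ u) (Complex.I • u) = 0 := by
    have hzero (v w : 𝓢(E, ℂ)) : weightedInner 0 v w = 0 := by simp [weightedInner]
    rw [weightedInner_laplacian_left (.const 1), hzero]
    simp only [lineDerivOp_smul, weightedInner_comm _ _ (Complex.I • _), weightedInner_I_smul_self,
      Finset.sum_const_zero, neg_zero, sub_zero]
  rw [weightedInner_helmholtz_left (.const 1), flux,
    weightedInner_comm _ u (Complex.I • u), weightedInner_I_smul_self, weightedInner_I_smul_I_smul]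
  ring

theorem morawetz_helmholtz {h h' h'' h''' : E → ℝ} (hh : HasRadialGradient h h')
    (hh' : HasRadialGradient h' h'') (hh'' : HasRadialGradient h'' h''') (z : ℂ) (u : 𝓢(E, ℂ)) :
    dirichlet h u + weightedInner h' (euler u) (euler u) =
      weightedInner h (helmholtz z u) (euler u)
        + 1 / 2 * weightedInner (radialDiv h h') (helmholtz z u) u
        + (z ^ 2).im * weightedInner h (Complex.I • u) (euler u)
        + 1 / 4 * weightedInner (radialDiv (radialDiv h' h'' + (2 : ℝ) • h')
          (radialDiv h'' h''' + (2 : ℝ) • h'' + (2 : ℝ) • h'')) u u := by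
  have transport := weightedInner_euler_left hh u u
  rw [weightedInner_comm h (euler u)] at transport
  rw [morawetz_identity hh hh' hh'', weightedInner_helmholtz_left hh.hasTemperateGrowth,
    weightedInner_helmholtz_left (hh.radialDiv hh').hasTemperateGrowth, weightedInner_I_smul_self]
  linear_combination (z ^ 2).re / 2 * transport

end Helmholtz

section MorawetzMultiplier

variable {E : Type*} [NormedAddCommGroup E]

/-- The chain of radial gradients starting at the profile `h = 2⟨x⟩⁻¹ - ⟨x⟩^(-1-e)` of the Morawetz
multiplier `h(x) x · ∇u`. The second term makes the derivative of the vector field `h(x) x` bounded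
below by `e ⟨x⟩^(-1-e)`. -/
def morawetzProfile (e : ℝ) (n : ℕ) : E → ℝ :=
  (2 : ℝ) • bracketDeriv (-1) n + (-1 : ℝ) • bracketDeriv (-1 - e) n

theorem morawetzProfile_apply (e : ℝ) (n : ℕ) (x : E) : morawetzProfile e n x =
    bracket (-1) x ^ (2 * n + 1) * (2 * ∏ j ∈ Finset.range n, (-1 - 2 * (j : ℝ))
      - bracket (-e) x * ∏ j ∈ Finset.range n, (-1 - e - 2 * (j : ℝ))) := by
  have hsplit : bracket (-1 - e) x = bracket (-1) x * bracket (-e) x := by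
    rw [← bracket_add, sub_eq_add_neg]
  simp only [morawetzProfile, Pi.add_apply, Pi.smul_apply, smul_eq_mul, bracketDeriv_apply, hsplit]
  ring

theorem morawetzProfile_zero_apply (e : ℝ) (x : E) :
    morawetzProfile e 0 x = bracket (-1) x * (2 - bracket (-e) x) := by
  simp [morawetzProfile_apply]

theorem morawetzProfile_one_apply (e : ℝ) (x : E) :
    morawetzProfile e 1 x = bracket (-1) x ^ 3 * ((1 + e) * bracket (-e) x - 2) := by
  rw [morawetzProfile_apply, Finset.prod_range_one, Finset.prod_range_one]
  push_cast
  ring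

theorem abs_morawetzProfile_mul_norm_le {e : ℝ} (he : 0 ≤ e) (x : E) :
    |morawetzProfile e 0 x| * ‖x‖ ≤ 2 := by
  have hβ := bracket_pos (-e) x
  have hβ' := bracket_le_one (neg_nonpos.mpr he) x
  rw [morawetzProfile_zero_apply, abs_of_nonneg (mul_nonneg (bracket_pos _ x).le (by linarith))]
  nlinarith [norm_mul_bracket_neg_one_le x]

theorem bracket_mul_le_morawetzProfile {e : ℝ} (he : 0 ≤ e) (he' : e ≤ 1 / 5) (x : E) {S R : ℝ}
    (hS : 0 ≤ S) (hR : R ≤ ‖x‖ ^ 2 * S) :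
    e * bracket (-1 - e) x * S ≤ morawetzProfile e 0 x * S + morawetzProfile e 1 x * R := by
  have ht := norm_sq_mul_bracket_neg_one_sq x
  have hb := bracket_pos (-1) x
  have hβ := bracket_pos (-e) x
  have hβ' := bracket_le_one (neg_nonpos.mpr he) x
  have hb' := bracket_le_one (p := -1) (by norm_num) x
  rw [morawetzProfile_zero_apply, morawetzProfile_one_apply, sub_eq_add_neg, bracket_add]
  generalize bracket (-1) x = b, bracket (-e) x = β, ‖x‖ ^ 2 = t at *
  have hslope : b ^ 3 * ((1 + e) * β - 2) ≤ 0 :=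
    mul_nonpos_of_nonneg_of_nonpos (by positivity) (by nlinarith)
  have hradial : b * (2 - β) + b ^ 3 * ((1 + e) * β - 2) * t =
      e * (b * β) + b ^ 3 * (2 - (1 + e) * β) := by
    linear_combination b * ((1 + e) * β - 2) * ht
  have hform : e * (b * β) ≤ b * (2 - β) + b ^ 3 * ((1 + e) * β - 2) * t := by
    rw [hradial]
    linarith [(by ring : b ^ 3 * (2 - (1 + e) * β) = -(b ^ 3 * ((1 + e) * β - 2)))]
  calc e * (b * β) * S ≤ (b * (2 - β) + b ^ 3 * ((1 + e) * β - 2) * t) * S := by gcongr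
    _ = b * (2 - β) * S + b ^ 3 * ((1 + e) * β - 2) * (t * S) := by ring
    _ ≤ _ := by linarith [mul_le_mul_of_nonpos_left hR hslope]

variable [InnerProductSpace ℝ E]

theorem hasRadialGradient_morawetzProfile (e : ℝ) (n : ℕ) :
    HasRadialGradient (morawetzProfile e n : E → ℝ) (morawetzProfile e (n + 1)) :=
  ((hasRadialGradient_bracketDeriv _ n).const_smul _).add
    ((hasRadialGradient_bracketDeriv _ n).const_smul _)

variable [FiniteDimensional ℝ E] [MeasurableSpace E] [BorelSpace E]

theorem mul_dirichlet_bracket_le_morawetz {e : ℝ} (he : 0 ≤ e) (he' : e ≤ 1 / 5) (u : 𝓢(E, ℂ)) :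
    e * dirichlet (bracket (-1 - e)) u ≤ dirichlet (morawetzProfile e 0) u
      + weightedInner (morawetzProfile e 1) (euler u) (euler u) := by
  have hw : (bracket (-1 - e) : E → ℝ).HasTemperateGrowth := by fun_prop
  have hprofile n := (hasRadialGradient_morawetzProfile (E := E) e n).hasTemperateGrowth
  have hint₀ := integrable_weight_mul_sum_norm_sq (hprofile 0) u
  have hint₁ := integrable_weight_mul_norm_sq (hprofile 1) (euler u)
  rw [dirichlet_eq_integral hw, dirichlet_eq_integral (hprofile 0), weightedInner_self,
    ← integral_const_mul, ← integral_add hint₀ hint₁]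
  refine integral_mono ((integrable_weight_mul_sum_norm_sq hw u).const_mul e) (hint₀.add hint₁)
    fun x => ?_
  rw [← mul_assoc]
  exact bracket_mul_le_morawetzProfile he he' x (Finset.sum_nonneg fun i _ => sq_nonneg _)
    (norm_euler_sq_le _ u x)

theorem abs_weightedInner_morawetzProfile_euler_le {e t : ℝ} (he : 0 ≤ e) (ht : 0 < t) (p : ℝ)
    (a u : 𝓢(E, ℂ)) : |weightedInner (morawetzProfile e 0) a (euler u)| ≤
      t⁻¹ * weightedInner (bracket (-p)) a a + t * dirichlet (bracket p) u := by
  have hsq (x : E) : morawetzProfile e 0 x ^ 2 * ‖x‖ ^ 2 ≤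
      ((2 * t⁻¹) • bracket (-p)) x * ((2 * t) • bracket p) x := by
    calc morawetzProfile e 0 x ^ 2 * ‖x‖ ^ 2 = (|morawetzProfile e 0 x| * ‖x‖) ^ 2 := by
          rw [mul_pow, sq_abs]
      _ ≤ 2 ^ 2 := by gcongr; exact abs_morawetzProfile_mul_norm_le he x
      _ = _ := by
          have := (bracket_pos p x).ne'
          simp only [Pi.smul_apply, smul_eq_mul, bracket_neg]
          field_simp
  have key := abs_weightedInner_euler_le
    ((hasRadialGradient_bracket (-p)).const_smul _).hasTemperateGrowth
    ((hasRadialGradient_bracket p).const_smul _).hasTemperateGrowth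
    (fun x => mul_nonneg (by positivity) (bracket_pos _ x).le)
    (fun x => mul_nonneg (by positivity) (bracket_pos _ x).le) hsq a u
  rw [weightedInner_const_smul, dirichlet_const_smul] at key
  linarith

theorem abs_weightedInner_bracket_le {W : E → ℝ} {B t : ℝ} (hW : ∀ x, |W x| ≤ B) (hB : 0 < B)
    (ht : 0 < t) (p : ℝ) (a b : 𝓢(E, ℂ)) : |weightedInner W a b| ≤
      B * ((t⁻¹ * weightedInner (bracket (-p)) a a + t * weightedInner (bracket p) b b) / 2) := by
  have hsq (x : E) : W x ^ 2 ≤ ((B * t⁻¹) • bracket (-p)) x * ((B * t) • bracket p) x := by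
    calc W x ^ 2 ≤ B ^ 2 := sq_le_sq' (neg_le_of_abs_le (hW x)) (le_of_abs_le (hW x))
      _ = _ := by
          have := (bracket_pos p x).ne'
          simp only [Pi.smul_apply, smul_eq_mul, bracket_neg]
          field_simp
  have key := abs_weightedInner_le
    ((hasRadialGradient_bracket (-p)).const_smul _).hasTemperateGrowth
    ((hasRadialGradient_bracket p).const_smul _).hasTemperateGrowth
    (fun x => mul_nonneg (by positivity) (bracket_pos _ x).le)
    (fun x => mul_nonneg (by positivity) (bracket_pos _ x).le) hsq a b
  rw [weightedInner_const_smul, weightedInner_const_smul] at key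
  linarith

end MorawetzMultiplier

section WeightedHelmholtzEstimate

theorem finrank_R3 : (Module.finrank ℝ R3 : ℝ) = 3 := by simp

theorem abs_radialDiv_morawetzProfile_le {e : ℝ} (he : 0 ≤ e) (he' : e ≤ 1 / 5) (x : R3) :
    |radialDiv (morawetzProfile e 0) (morawetzProfile e 1) x| ≤ 6 := by
  have ht := norm_sq_mul_bracket_neg_one_sq x
  have hb := bracket_pos (-1) x
  have hb' := bracket_le_one (p := -1) (by norm_num) x
  have hβ := bracket_pos (-e) x
  have hβ' := bracket_le_one (neg_nonpos.mpr he) x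
  rw [radialDiv, finrank_R3, morawetzProfile_zero_apply, morawetzProfile_one_apply]
  generalize bracket (-1) x = b, bracket (-e) x = β, ‖x‖ ^ 2 = t at *
  have hdiv : 3 * (b * (2 - β)) + t * (b ^ 3 * ((1 + e) * β - 2)) =
      b * (4 - (2 - e) * β) + b ^ 3 * (2 - (1 + e) * β) := by
    linear_combination b * ((1 + e) * β - 2) * ht
  have hcoeff₁ : 0 ≤ (2 - e) * β ∧ (2 - e) * β ≤ 4 := by constructor <;> nlinarith
  have hcoeff₂ : 0 ≤ (1 + e) * β ∧ (1 + e) * β ≤ 2 := by constructor <;> nlinarith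
  rw [hdiv, abs_of_nonneg (add_nonneg (mul_nonneg hb.le (by linarith))
    (mul_nonneg (by positivity) (by linarith)))]
  calc b * (4 - (2 - e) * β) + b ^ 3 * (2 - (1 + e) * β) ≤ 1 * 4 + 1 * 2 :=
        add_le_add (mul_le_mul hb' (by linarith) (by linarith) zero_le_one)
          (mul_le_mul (pow_le_one₀ hb.le hb') (by linarith) (by linarith) zero_le_one)
    _ = 6 := by norm_num

theorem laplacian_radialDiv_morawetzProfile_nonpos {e : ℝ} (he : 0 ≤ e) (he' : e ≤ 1 / 5)
    (x : R3) :
    radialDiv (radialDiv (morawetzProfile e 1) (morawetzProfile e 2)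
        + (2 : ℝ) • morawetzProfile e 1)
      (radialDiv (morawetzProfile e 2) (morawetzProfile e 3) + (2 : ℝ) • morawetzProfile e 2
        + (2 : ℝ) • morawetzProfile e 2) x ≤ 0 := by
  have ht := norm_sq_mul_bracket_neg_one_sq x
  have hb := bracket_pos (-1) x
  have hβ := bracket_pos (-e) x
  have hβ' := bracket_le_one (neg_nonpos.mpr he) x
  simp only [radialDiv, Pi.add_apply, Pi.smul_apply, smul_eq_mul, finrank_R3,
    morawetzProfile_apply, Finset.prod_range_succ, Finset.prod_range_zero]
  push_cast
  generalize bracket (-1) x = b, bracket (-e) x = β, ‖x‖ ^ 2 = t at *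
  have hcoeff : (1 + e) * (3 + e) * (5 + e) ≤ 30 := by
    calc (1 + e) * (3 + e) * (5 + e) ≤ (1 + 1 / 5) * (3 + 1 / 5) * (5 + 1 / 5) := by gcongr
      _ ≤ 30 := by norm_num
  have hlead : (1 + e) * (3 + e) * (5 + e) * β ≤ 30 := by
    simpa using mul_le_mul hcoeff hβ' hβ.le (by norm_num)
  have hfactor : 0 ≤ b ^ 7 * (30 - (1 + e) * (3 + e) * (5 + e) * β) +
      β * ((1 + e) * e * (2 - e) * b ^ 3 + 2 * e * (1 + e) * (3 + e) * b ^ 5) := by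
    have h₁ := sub_nonneg.mpr hlead
    have h₂ : 0 ≤ 2 - e := by linarith
    exact add_nonneg (mul_nonneg (by positivity) h₁) (by positivity)
  refine le_of_eq_of_le ?_ (neg_nonpos.mpr hfactor)
  linear_combination (10 * b ^ 3 * (6 - (1 + e) * (3 + e) * β)
    + b ^ 3 * (t * b ^ 2 + 1 - b ^ 2) * (-30 + (1 + e) * (3 + e) * (5 + e) * β)) * ht

theorem neg_four_mul_bracket_le_laplacian {e : ℝ} (he : 0 ≤ e) (he' : e ≤ 1 / 5) (x : R3) :
    ((-4 : ℝ) • bracket (-1 - e)) x ≤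
      radialDiv (bracketDeriv (-1 - e) 1) (bracketDeriv (-1 - e) 2) x := by
  have ht := norm_sq_mul_bracket_neg_one_sq x
  have hb := bracket_pos (-1) x
  have hb' : bracket (-1) x ^ 4 ≤ 1 := pow_le_one₀ hb.le (bracket_le_one (by norm_num) x)
  simp only [radialDiv, finrank_R3, bracketDeriv_apply, Finset.prod_range_succ,
    Finset.prod_range_zero, Pi.smul_apply, smul_eq_mul]
  push_cast
  generalize bracket (-1) x = b, ‖x‖ ^ 2 = t at *
  have hdecay : (1 + e) * (3 + e) * b ^ 4 ≤ 4 := by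
    simpa using mul_le_mul (by nlinarith : (1 + e) * (3 + e) ≤ 4) hb' (by positivity) (by norm_num)
  have hcoeff : -4 ≤ e * (1 + e) * b ^ 2 - (1 + e) * (3 + e) * b ^ 4 := by
    have : 0 ≤ e * (1 + e) * b ^ 2 := by positivity
    linarith
  refine (mul_le_mul_of_nonneg_right hcoeff (bracket_pos (-1 - e) x).le).trans_eq ?_
  linear_combination -(1 + e) * (3 + e) * b ^ 2 * bracket (-1 - e) x * ht

theorem re_sq_mul_weightedInner_bracket_le {e : ℝ} (he : 0 ≤ e) (he' : e ≤ 1 / 5) (z : ℂ)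
    (u : 𝓢(R3, ℂ)) : (z ^ 2).re * weightedInner (bracket (-1 - e)) u u ≤
      dirichlet (bracket (-1 - e)) u + 2 * weightedInner (bracket (-1 - e)) u u
        + |weightedInner (bracket (-1 - e)) (helmholtz z u) u| := by
  set q := -1 - e
  have hgrad n := hasRadialGradient_bracketDeriv (E := R3) q n
  have hzero : bracketDeriv q 0 = (bracket q : R3 → ℝ) := by
    ext x
    simp [bracketDeriv]
  have energy := dirichlet_eq_helmholtz (hgrad 0) (hgrad 1) z u
  have hmono := weightedInner_self_mono
    ((hasRadialGradient_bracket q).const_smul (-4)).hasTemperateGrowth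
    ((hgrad 1).radialDiv (hgrad 2)).hasTemperateGrowth
    (neg_four_mul_bracket_le_laplacian he he') u
  rw [weightedInner_const_smul] at hmono
  rw [hzero] at energy
  linarith [neg_abs_le (weightedInner (bracket q) (helmholtz z u) u)]

theorem mul_dirichlet_bracket_le {e : ℝ} (he : 0 ≤ e) (he' : e ≤ 1 / 5) {z : ℂ}
    (hz : 0 ≤ (z ^ 2).im) (u : 𝓢(R3, ℂ)) {t s : ℝ} (ht : 0 < t) (hs : 0 < s) :
    e * dirichlet (bracket (-1 - e)) u ≤
      t⁻¹ * weightedInner (bracket (1 + e)) (helmholtz z u) (helmholtz z u)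
        + t * dirichlet (bracket (-1 - e)) u
        + 1 / 2 * |weightedInner (radialDiv (morawetzProfile e 0) (morawetzProfile e 1))
            (helmholtz z u) u|
        + (z ^ 2).im * (s⁻¹ * weightedInner (bracket 0) u u + s * dirichlet (bracket 0) u) := by
  have hgrad n := hasRadialGradient_morawetzProfile (E := R3) e n
  have source := abs_weightedInner_morawetzProfile_euler_le he ht (-1 - e) (helmholtz z u) u
  have absorption := abs_weightedInner_morawetzProfile_euler_le he hs 0 (Complex.I • u) u
  rw [weightedInner_I_smul_I_smul, neg_zero] at absorption
  rw [show -(-1 - e) = 1 + e by ring] at source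
  have hlaplacian := weightedInner_self_mono (((hgrad 1).radialDiv (hgrad 2)).add
      ((hgrad 1).const_smul 2) |>.radialDiv ((((hgrad 2).radialDiv (hgrad 3)).add
      ((hgrad 2).const_smul 2)).add ((hgrad 2).const_smul 2))).hasTemperateGrowth (.const 0)
    (laplacian_radialDiv_morawetzProfile_nonpos he he') u
  have hzero : weightedInner (fun _ => 0) u u = 0 := by simp [weightedInner]
  have := mul_le_mul_of_nonneg_left ((le_abs_self _).trans absorption) hz
  linarith [mul_dirichlet_bracket_le_morawetz he he' u,
    morawetz_helmholtz (hgrad 0) (hgrad 1) (hgrad 2) z u, (le_abs_self _).trans source,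
    le_abs_self (weightedInner (radialDiv (morawetzProfile e 0) (morawetzProfile e 1))
      (helmholtz z u) u)]

theorem weightedInner_bracket_self_nonneg (p : ℝ) (u : 𝓢(R3, ℂ)) :
    0 ≤ weightedInner (bracket p) u u :=
  weightedInner_self_nonneg (fun x => (bracket_pos p x).le) u

theorem mass_and_dirichlet_le {e : ℝ} {z : ℂ} {τ : ℝ} (hτ : 0 < τ) (u : 𝓢(R3, ℂ)) {P : ℝ}
    (hP : P = (τ⁻¹ * weightedInner (bracket (1 + e)) (helmholtz z u) (helmholtz z u)
      + τ * weightedInner (bracket (-1 - e)) u u) / 2) :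
    (z ^ 2).im * weightedInner (bracket 0) u u ≤ P ∧
      dirichlet (bracket 0) u ≤ (z ^ 2).re * weightedInner (bracket 0) u u + P := by
  have hone : (bracket 0 : R3 → ℝ) = fun _ => 1 := funext bracket_zero
  have bound (v : 𝓢(R3, ℂ)) := abs_weightedInner_bracket_le (W := fun _ : R3 => 1) (B := 1)
    (by simp) one_pos hτ (-1 - e) (helmholtz z u) v
  have hmass := bound (Complex.I • u)
  have hdirichlet := bound u
  rw [weightedInner_I_smul_I_smul, one_mul, neg_sub, sub_neg_eq_add, add_comm e, ← hP] at hmass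
  rw [one_mul, neg_sub, sub_neg_eq_add, add_comm e, ← hP] at hdirichlet
  have energy := dirichlet_eq_helmholtz (E := R3) (.const 1) (.const 0) z u
  have hzero : weightedInner (radialDiv (0 : R3 → ℝ) 0) u u = 0 := by
    simp [weightedInner, radialDiv]
  rw [hone, im_sq_mul_weightedInner_eq]
  exact ⟨(neg_le_abs _).trans hmass, by
    linarith! [le_abs_self (weightedInner (fun _ => 1) (helmholtz z u) u)]⟩

theorem absorption_le {k η U V P : ℝ} (hk : 2 ≤ k) (hη : 0 ≤ η) (hη' : η ≤ 1) (hU : 0 ≤ U)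
    (hP : 0 ≤ P) (mass : 2 * k * η * U ≤ P) (energy : V ≤ (k ^ 2 - η ^ 2) * U + P) :
    2 * k * η * (k * U + k⁻¹ * V) ≤ 3 * k * P := by
  have : 0 < k := by linarith
  have hV : V ≤ k ^ 2 * U + P := by nlinarith [mul_nonneg (sq_nonneg η) hU]
  calc 2 * k * η * (k * U + k⁻¹ * V) ≤ 2 * k * η * (k * U + k⁻¹ * (k ^ 2 * U + P)) := by gcongr
    _ = 2 * k * (2 * k * η * U) + 2 * η * P := by field_simp; ring
    _ ≤ 2 * k * P + k * P := by gcongr; linarith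
    _ = 3 * k * P := by ring

theorem sq_mul_le_of_energy_of_morawetz {e k η X Y P Φ : ℝ} (he : 0 < e) (he' : e ≤ 1 / 5)
    (hk : 2 ≤ k) (hη : 0 ≤ η) (hη' : η ≤ 1) (hX : 0 ≤ X) (hΦ : 0 ≤ Φ)
    (hP : P = ((e * k / 40)⁻¹ * Φ + e * k / 40 * X) / 2)
    (energy : (k ^ 2 - η ^ 2) * X ≤ Y + 2 * X + P)
    (morawetz : e * Y ≤ (e / 2)⁻¹ * Φ + e / 2 * Y + 3 * P + 3 * k * P) :
    k ^ 2 * X ≤ (41 / e) ^ 2 * Φ := by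
  have hP₀ : 0 ≤ P := by rw [hP]; positivity
  have hkP : P ≤ k * P / 2 := by nlinarith
  have hY : Y ≤ 4 / e ^ 2 * Φ + 9 / e * (k * P) := by
    calc Y = 2 / e * (e * Y - e / 2 * Y) := by field_simp; ring
      _ ≤ 2 / e * ((e / 2)⁻¹ * Φ + 9 / 2 * (k * P)) := by gcongr; linarith
      _ = _ := by field_simp; ring
  have hP' : P ≤ 1 / e * (k * P) := by
    have h : 1 ≤ 1 / e := by rw [le_div_iff₀ he]; linarith
    nlinarith [mul_nonneg (by linarith : 0 ≤ k) hP₀]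
  have habsorbed : 10 / e * (k * P) = 200 / e ^ 2 * Φ + 1 / 8 * (k ^ 2 * X) := by
    rw [hP]
    field_simp
    ring
  have hleft : 1 / 4 * k ^ 2 * X ≤ (k ^ 2 - η ^ 2 - 2) * X := by
    gcongr
    nlinarith
  have hsum : 9 / e * (k * P) + 1 / e * (k * P) = 10 / e * (k * P) := by ring
  calc k ^ 2 * X ≤ 8 * (204 / e ^ 2 * Φ) := by
        linarith [(by ring : 204 / e ^ 2 * Φ = 4 / e ^ 2 * Φ + 200 / e ^ 2 * Φ)]
    _ = 1632 / e ^ 2 * Φ := by ring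
    _ ≤ 1681 / e ^ 2 * Φ := by gcongr; norm_num
    _ = (41 / e) ^ 2 * Φ := by ring

theorem sq_mul_weightedInner_le_helmholtz {e : ℝ} (he : 0 < e) (he' : e ≤ 1 / 5) {k η : ℝ}
    (hk : 2 ≤ k) (hη : 0 ≤ η) (hη' : η ≤ 1) (u : 𝓢(R3, ℂ)) :
    k ^ 2 * weightedInner (bracket (-1 - e)) u u ≤ (41 / e) ^ 2 * weightedInner (bracket (1 + e))
      (helmholtz (k + η * Complex.I) u) (helmholtz (k + η * Complex.I) u) := by
  set z : ℂ := k + η * Complex.I with hz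
  have hre : (z ^ 2).re = k ^ 2 - η ^ 2 := by simp [hz, sq]
  have him : (z ^ 2).im = 2 * k * η := by simp [hz, sq]; ring
  have hX := weightedInner_bracket_self_nonneg (-1 - e) u
  have hU := weightedInner_bracket_self_nonneg 0 u
  have hΦ := weightedInner_bracket_self_nonneg (1 + e) (helmholtz z u)
  have energy := re_sq_mul_weightedInner_bracket_le he.le he' z u
  have morawetz := mul_dirichlet_bracket_le he.le he' (z := z) (by rw [him]; positivity) u
    (t := e / 2) (s := k⁻¹) (by positivity) (by positivity)
  have hτ : 0 < e * k / 40 := by positivity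
  obtain ⟨P, hP⟩ : ∃ P, P = ((e * k / 40)⁻¹ * weightedInner (bracket (1 + e)) (helmholtz z u)
    (helmholtz z u) + e * k / 40 * weightedInner (bracket (-1 - e)) u u) / 2 := ⟨_, rfl⟩
  obtain ⟨mass, dirichlet_le⟩ := mass_and_dirichlet_le hτ u hP
  have hP₀ : 0 ≤ P := by rw [hP]; positivity
  have bound {W : R3 → ℝ} {B : ℝ} (hW : ∀ x, |W x| ≤ B) (hB : 0 < B) :
      |weightedInner W (helmholtz z u) u| ≤ B * P := by
    simpa only [neg_sub, sub_neg_eq_add, add_comm e, ← hP] using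
      abs_weightedInner_bracket_le hW hB hτ (-1 - e) (helmholtz z u) u
  have energy_source := bound (W := bracket (-1 - e)) (B := 1) (fun x => by
    rw [abs_of_pos (bracket_pos _ x)]; exact bracket_le_one (by linarith) x) one_pos
  have morawetz_source := bound (abs_radialDiv_morawetzProfile_le he.le he') (by norm_num)
  rw [hre] at energy dirichlet_le
  rw [him] at mass morawetz
  rw [inv_inv] at morawetz
  refine sq_mul_le_of_energy_of_morawetz (Y := dirichlet (bracket (-1 - e)) u) he he' hk hη hη'
    hX hΦ hP (by linarith) ?_
  linarith [absorption_le hk hη hη' hU hP₀ mass dirichlet_le]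

end WeightedHelmholtzEstimate

section KernelIntegrals

section

variable {E : Type*} [NormedAddCommGroup E]

theorem bracket_one_eq_sqrt (x : E) : bracket 1 x = √(1 + ‖x‖ ^ 2) := (Real.sqrt_eq_rpow _).symm

theorem bracket_one_le_add (x y : E) : bracket 1 y ≤ bracket 1 x + ‖x - y‖ := by
  have hy : ‖y‖ ≤ ‖x‖ + ‖x - y‖ := by simpa using norm_sub_le x (x - y)
  have hx : ‖x‖ ≤ √(1 + ‖x‖ ^ 2) := Real.le_sqrt_of_sq_le (by linarith)
  have hsq : √(1 + ‖x‖ ^ 2) ^ 2 = 1 + ‖x‖ ^ 2 := Real.sq_sqrt (by positivity)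
  rw [bracket_one_eq_sqrt, bracket_one_eq_sqrt, Real.sqrt_le_left (by positivity)]
  nlinarith [norm_nonneg y, norm_nonneg (x - y)]

theorem bracket_one_mul_inv_norm_mul_bracket_le (x y : E) :
    bracket 1 y * (‖x - y‖⁻¹ * bracket (-5) x)
      ≤ ‖x - y‖⁻¹ * bracket (-4) x + bracket (-5) x := by
  have h₁₅ : bracket 1 x * bracket (-5) x = bracket (-4) x := by rw [← bracket_add]; norm_num
  have := (bracket_pos (-5) x).le
  calc _ ≤ (bracket 1 x + ‖x - y‖) * (‖x - y‖⁻¹ * bracket (-5) x) := by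
        gcongr
        exact bracket_one_le_add x y
    _ = ‖x - y‖⁻¹ * (bracket 1 x * bracket (-5) x)
          + (‖x - y‖ * ‖x - y‖⁻¹) * bracket (-5) x := by ring
    _ ≤ _ := by
        rw [h₁₅]
        gcongr
        exact mul_le_of_le_one_left this mul_inv_le_one

theorem integrable_bracket [NormedSpace ℝ E] [FiniteDimensional ℝ E] [MeasurableSpace E]
    [BorelSpace E] (μ : Measure E) [μ.IsAddHaarMeasure] {p : ℝ} (hp : Module.finrank ℝ E < p) :
    Integrable (bracket (-p)) μ :=
  integrable_rpow_neg_one_add_norm_sq hp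

variable [InnerProductSpace ℝ E]

@[fun_prop]
theorem continuous_bracket (p : ℝ) : Continuous (bracket p : E → ℝ) :=
  (bracket_hasTemperateGrowth p).1.continuous

theorem exists_norm_le_mul_bracket {F : Type*} [NormedAddCommGroup F] [NormedSpace ℝ F]
    (ψ : 𝓢(E, F)) (p : ℝ) : ∃ M, 0 ≤ M ∧ ∀ x, ‖ψ x‖ ≤ M * bracket (-p) x := by
  refine ⟨SchwartzMap.seminorm ℝ 0 0 (SchwartzMap.smulLeftCLM F (bracket p) ψ),
    apply_nonneg _ _, fun x => ?_⟩
  have h := SchwartzMap.norm_le_seminorm ℝ (SchwartzMap.smulLeftCLM F (bracket p) ψ) x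
  rw [SchwartzMap.smulLeftCLM_apply_apply (by fun_prop), norm_smul,
    Real.norm_of_nonneg (bracket_pos p x).le] at h
  rwa [bracket_neg, ← div_eq_mul_inv, le_div_iff₀' (bracket_pos p x)]

end

theorem integrableOn_ball_inv_norm :
    IntegrableOn (fun x : R3 => ‖x‖⁻¹) (Metric.ball (0 : R3) 1) := by
  rw [integrableOn_fun_norm_addHaar volume (f := fun r : ℝ => r⁻¹)]
  have h : IntegrableOn (fun r : ℝ => r) (Set.Ioo 0 1) :=
    (continuous_id.integrableOn_Icc (a := 0) (b := 1)).mono_set Set.Ioo_subset_Icc_self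
  refine h.congr_fun (fun r hr => ?_) measurableSet_Ioo
  have : r ≠ 0 := hr.1.ne'
  simp only [finrank_euclideanSpace, Fintype.card_fin, smul_eq_mul]
  field_simp

theorem exists_integral_inv_norm_mul_bracket_le : ∃ K, ∀ y : R3,
    Integrable (fun x : R3 => ‖x - y‖⁻¹ * bracket (-4) x) ∧
      ∫ x : R3, ‖x - y‖⁻¹ * bracket (-4) x ≤ K := by
  set h : R3 → ℝ := (Metric.ball (0 : R3) 1).indicator fun x => ‖x‖⁻¹ with hdef
  have hint : Integrable h :=
    (integrable_indicator_iff measurableSet_ball).2 integrableOn_ball_inv_norm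
  have bracket_int : Integrable (bracket (-4) : R3 → ℝ) := integrable_bracket volume (by norm_num)
  have le_split (y x : R3) : ‖x - y‖⁻¹ * bracket (-4) x ≤ h (x - y) + bracket (-4) x := by
    have h0 := bracket_pos (-4) x
    by_cases hx : x - y ∈ Metric.ball (0 : R3) 1
    · have near : ‖x - y‖⁻¹ * bracket (-4) x ≤ ‖x - y‖⁻¹ :=
        mul_le_of_le_one_right (by positivity) (bracket_le_one (by norm_num) x)
      rw [hdef, Set.indicator_of_mem hx]
      linarith
    · have far : ‖x - y‖⁻¹ ≤ 1 := inv_le_one_of_one_le₀ (by simpa using hx)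
      rw [hdef, Set.indicator_of_notMem hx]
      nlinarith
  have split_int (y : R3) : Integrable (fun x : R3 => h (x - y) + bracket (-4) x) :=
    (hint.comp_sub_right y).add bracket_int
  refine ⟨(∫ x, h x) + ∫ x : R3, bracket (-4) x, fun y => ?_⟩
  have hI : Integrable (fun x : R3 => ‖x - y‖⁻¹ * bracket (-4) x) := by
    refine (split_int y).mono' (Measurable.aestronglyMeasurable (by fun_prop)) (.of_forall
      fun x => ?_)
    rw [Real.norm_of_nonneg (mul_nonneg (by positivity) (bracket_pos _ _).le)]
    exact le_split y x
  refine ⟨hI, (integral_mono hI (split_int y) (le_split y)).trans (le_of_eq ?_)⟩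
  rw [integral_add (hint.comp_sub_right y) bracket_int, integral_sub_right_eq_self]

theorem exists_integral_inv_norm_mul_schwartz_le (ψ : 𝓢(R3, ℂ)) : ∃ C, 0 ≤ C ∧ ∀ y : R3,
    Integrable (fun x : R3 => ‖x - y‖⁻¹ * ‖ψ x‖) ∧
      ∫ x : R3, ‖x - y‖⁻¹ * ‖ψ x‖ ≤ C * bracket (-1) y := by
  obtain ⟨K, hK⟩ := exists_integral_inv_norm_mul_bracket_le
  obtain ⟨M, hM, hψ⟩ := exists_norm_le_mul_bracket ψ 5
  have hK₀ : 0 ≤ K :=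
    (integral_nonneg fun x => mul_nonneg (by positivity) (bracket_pos _ _).le).trans (hK 0).2
  have bracket_int : Integrable (bracket (-5) : R3 → ℝ) := integrable_bracket volume (by norm_num)
  have hL : 0 ≤ ∫ x : R3, bracket (-5) x := integral_nonneg fun x => (bracket_pos _ _).le
  refine ⟨M * (K + ∫ x : R3, bracket (-5) x), by positivity, fun y => ?_⟩
  have hI : Integrable (fun x : R3 => ‖x - y‖⁻¹ * ‖ψ x‖) := by
    refine ((hK y).1.const_mul M).mono' (Measurable.aestronglyMeasurable
      (by have := ψ.continuous.measurable; fun_prop)) (.of_forall fun x => ?_)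
    rw [Real.norm_of_nonneg (by positivity), mul_left_comm]
    gcongr
    exact (hψ x).trans (by gcongr; exact bracket_mono (by norm_num) x)
  have le_split (x : R3) : bracket 1 y * (‖x - y‖⁻¹ * ‖ψ x‖)
      ≤ M * (‖x - y‖⁻¹ * bracket (-4) x + bracket (-5) x) := by
    have := (bracket_pos 1 y).le
    calc _ ≤ bracket 1 y * (‖x - y‖⁻¹ * (M * bracket (-5) x)) := by gcongr; exact hψ x
      _ = M * (bracket 1 y * (‖x - y‖⁻¹ * bracket (-5) x)) := by ring
      _ ≤ _ := by gcongr; exact bracket_one_mul_inv_norm_mul_bracket_le x y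
  refine ⟨hI, ?_⟩
  rw [bracket_neg, ← div_eq_mul_inv, le_div_iff₀' (bracket_pos 1 y), ← integral_const_mul]
  refine (integral_mono (hI.const_mul _) (((hK y).1.add bracket_int).const_mul M) le_split).trans ?_
  simp only [Pi.add_apply]
  rw [integral_const_mul, integral_add (hK y).1 bracket_int]
  gcongr
  exact (hK y).2

theorem hasDerivAt_pow_three_mul_rpow (r : ℝ) :
    HasDerivAt (fun r : ℝ => 1 / 3 * (r ^ 3 * (1 + r ^ 2) ^ (-3 / 2 : ℝ)))
      (r ^ 2 * (1 + r ^ 2) ^ (-5 / 2 : ℝ)) r := by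
  have hinner : HasDerivAt (fun r : ℝ => 1 + r ^ 2) (2 * r) r := by
    simpa using (hasDerivAt_pow 2 r).const_add 1
  have hpow := hinner.rpow_const (p := (-3 / 2 : ℝ)) (Or.inl (by positivity))
  convert! ((hasDerivAt_pow 3 r).mul hpow).const_mul (1 / 3 : ℝ) using 1
  have e₃ : (1 + r ^ 2) ^ (-3 / 2 : ℝ) = (1 + r ^ 2) ^ (-5 / 2 : ℝ) * (1 + r ^ 2) := by
    rw [← Real.rpow_add_one (by positivity)]; norm_num
  have e₅ : (1 + r ^ 2) ^ (-3 / 2 - 1 : ℝ) = (1 + r ^ 2) ^ (-5 / 2 : ℝ) := by norm_num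
  rw [e₃, e₅]
  push_cast
  ring

theorem tendsto_pow_three_mul_rpow :
    Tendsto (fun r : ℝ => 1 / 3 * (r ^ 3 * (1 + r ^ 2) ^ (-3 / 2 : ℝ))) atTop (𝓝 (1 / 3)) := by
  have h : Tendsto (fun r : ℝ => 1 / 3 * ((1 + (r ^ 2)⁻¹) ^ (-3 / 2 : ℝ))) atTop
      (𝓝 (1 / 3 * ((1 + 0) ^ (-3 / 2 : ℝ)))) :=
    (((tendsto_inv_atTop_zero.comp (tendsto_pow_atTop two_ne_zero)).const_add 1).rpow_const
      (Or.inl (by norm_num))).const_mul _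
  simp only [add_zero, Real.one_rpow, mul_one] at h
  refine h.congr' ?_
  filter_upwards [eventually_gt_atTop 0] with r hr
  have factor : 1 + r ^ 2 = r ^ 2 * (1 + (r ^ 2)⁻¹) := by field_simp; ring
  have power : (r ^ 2) ^ (-3 / 2 : ℝ) = (r ^ 3)⁻¹ := by
    rw [← Real.rpow_natCast r 2, ← Real.rpow_mul hr.le, ← Real.rpow_natCast r 3,
      ← Real.rpow_neg hr.le]
    norm_num
  rw [factor, Real.mul_rpow (by positivity) (by positivity), power]
  field_simp

theorem integral_bracket_neg_five : ∫ w : R3, bracket (-5) w = 4 * Real.pi / 3 := by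
  have polar := integral_fun_norm_addHaar (volume : Measure R3)
    (fun r : ℝ => (1 + r ^ 2) ^ (-5 / 2 : ℝ))
  have radial : ∫ r in Set.Ioi (0 : ℝ), r ^ 2 * (1 + r ^ 2) ^ (-5 / 2 : ℝ) = 1 / 3 := by
    rw [integral_Ioi_of_hasDerivAt_of_nonneg' (fun r _ => hasDerivAt_pow_three_mul_rpow r)
      (fun r _ => by positivity) tendsto_pow_three_mul_rpow]
    simp
  have ball : (volume : Measure R3).real (Metric.ball 0 1) = Real.pi * 4 / 3 := by
    rw [Measure.real, EuclideanSpace.volume_ball_fin_three]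
    simp [ENNReal.toReal_ofReal (by positivity : 0 ≤ Real.pi * 4 / 3)]
  simp only [finrank_euclideanSpace, Fintype.card_fin, Nat.add_one_sub_one, smul_eq_mul,
    radial, ball, nsmul_eq_mul] at polar
  refine polar.trans ?_
  push_cast
  ring

end KernelIntegrals

section RadialConvolution

/-- The class of the radial profiles of the outgoing kernel and of its derivatives: functions
continuous on `(0, ∞)` and bounded away from their singularity at `0`. -/
structure IsRadialProfile (h : ℝ → ℂ) : Prop where
  continuousOn : ContinuousOn h (Set.Ioi 0)
  bounded (a : ℝ) (ha : 0 < a) : ∃ C, ∀ r, a ≤ r → ‖h r‖ ≤ C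

namespace IsRadialProfile

variable {h g : ℝ → ℂ}

theorem sub (hh : IsRadialProfile h) (hg : IsRadialProfile g) : IsRadialProfile (h - g) where
  continuousOn := hh.continuousOn.sub hg.continuousOn
  bounded a ha := by
    obtain ⟨C, hC⟩ := hh.bounded a ha
    obtain ⟨D, hD⟩ := hg.bounded a ha
    exact ⟨C + D, fun r hr => (norm_sub_le _ _).trans (add_le_add (hC r hr) (hD r hr))⟩

theorem mul (hh : IsRadialProfile h) (hg : IsRadialProfile g) : IsRadialProfile (h * g) where
  continuousOn := hh.continuousOn.mul hg.continuousOn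
  bounded a ha := by
    obtain ⟨C, hC⟩ := hh.bounded a ha
    obtain ⟨D, hD⟩ := hg.bounded a ha
    refine ⟨C * D, fun r hr => ?_⟩
    rw [Pi.mul_apply, norm_mul]
    exact mul_le_mul (hC r hr) (hD r hr) (norm_nonneg _) ((norm_nonneg _).trans (hC r hr))

theorem const_div_pow (c : ℂ) (n : ℕ) : IsRadialProfile (fun r => c / (r : ℂ) ^ n) where
  continuousOn := ContinuousOn.div₀ (by fun_prop) (by fun_prop) fun r hr =>
    pow_ne_zero _ (Complex.ofReal_ne_zero.2 (ne_of_gt hr))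
  bounded a ha := by
    refine ⟨‖c‖ / a ^ n, fun r hr => ?_⟩
    rw [norm_div, norm_pow, Complex.norm_real, Real.norm_of_nonneg (ha.le.trans hr)]
    gcongr

end IsRadialProfile

/-- The regularization `√(a² + ‖y‖²)` of the norm, smooth in `y` for `a ≠ 0`. -/
def regNorm {E : Type*} [Norm E] (a : ℝ) (y : E) : ℝ := √(a ^ 2 + ‖y‖ ^ 2)

variable {E : Type*} [NormedAddCommGroup E] {a : ℝ}

theorem regNorm_pos (ha : 0 < a) (y : E) : 0 < regNorm a y := by unfold regNorm; positivity

theorem le_regNorm (a : ℝ) (y : E) : a ≤ regNorm a y :=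
  Real.le_sqrt_of_sq_le (by linarith [sq_nonneg ‖y‖])

theorem norm_le_regNorm (a : ℝ) (y : E) : ‖y‖ ≤ regNorm a y :=
  Real.le_sqrt_of_sq_le (by linarith [sq_nonneg a])

theorem regNorm_sq (a : ℝ) (y : E) : regNorm a y ^ 2 = a ^ 2 + ‖y‖ ^ 2 :=
  Real.sq_sqrt (by positivity)

theorem continuous_regNorm (a : ℝ) : Continuous (regNorm a : E → ℝ) := by
  unfold regNorm; fun_prop

theorem regNorm_smul [NormedSpace ℝ E] (ha : 0 < a) (w : E) :
    regNorm a (a • w) = a * bracket 1 w := by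
  rw [bracket_one_eq_sqrt, regNorm, norm_smul, Real.norm_of_nonneg ha.le, mul_pow,
    show a ^ 2 + a ^ 2 * ‖w‖ ^ 2 = a ^ 2 * (1 + ‖w‖ ^ 2) by ring, Real.sqrt_mul (by positivity),
    Real.sqrt_sq ha.le]

variable [InnerProductSpace ℝ E] {h h' : ℝ → ℂ}

theorem hasLineDerivAt_comp_regNorm (ha : 0 < a) (m y : E)
    (hd : ∀ r, 0 < r → HasDerivAt h (r * h' r) r) :
    HasLineDerivAt ℝ (fun y => h (regNorm a y)) (⟪m, y⟫_ℝ * h' (regNorm a y)) y m := by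
  have hsq : HasFDerivAt (fun x : E => a ^ 2 + ‖x‖ ^ 2) (2 • (innerSL ℝ y)) y :=
    (hasStrictFDerivAt_norm_sq y).hasFDerivAt.const_add _
  have hreg : HasFDerivAt (regNorm a) ((regNorm a y)⁻¹ • innerSL ℝ y) y := by
    convert! hsq.sqrt (by positivity) using 1
    ext m
    simp [regNorm]
    ring
  have hr := regNorm_pos ha y
  convert! ((hd _ hr).hasFDerivAt.comp y hreg).hasLineDerivAt m using 1
  have : (regNorm a y : ℂ) ≠ 0 := by exact_mod_cast hr.ne'
  simp [real_inner_comm y m]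
  field_simp

variable [FiniteDimensional ℝ E] [MeasurableSpace E] [BorelSpace E]

theorem IsRadialProfile.integrable_mul (hh : IsRadialProfile h) (ha : 0 < a) (u : 𝓢(E, ℂ)) :
    Integrable (fun y => h (regNorm a y) * u y) := by
  obtain ⟨C, hC⟩ := hh.bounded a ha
  have hcont : Continuous (fun y : E => h (regNorm a y)) :=
    hh.continuousOn.comp_continuous (continuous_regNorm a) (regNorm_pos ha)
  exact u.integrable.bdd_mul hcont.aestronglyMeasurable (.of_forall fun y => hC _ (le_regNorm a y))

theorem integral_regNorm_mul_lineDeriv (ha : 0 < a) (hh : IsRadialProfile h)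
    (hh' : IsRadialProfile h') (hd : ∀ r, 0 < r → HasDerivAt h (r * h' r) r) (m : E)
    (u : 𝓢(E, ℂ)) :
    ∫ y, h (regNorm a y) * (∂_{m} u) y
      = -∫ y, h' (regNorm a y) * SchwartzMap.smulLeftCLM ℂ (⟪m, ·⟫_ℝ) u y := by
  have inner_int : Integrable (fun y => ⟪m, y⟫_ℝ * h' (regNorm a y) * u y) := by
    refine (hh'.integrable_mul ha (SchwartzMap.smulLeftCLM ℂ (⟪m, ·⟫_ℝ) u)).congr
      (.of_forall fun y => ?_)
    simp only [SchwartzMap.smulLeftCLM_apply_apply (by fun_prop : (⟪m, ·⟫_ℝ).HasTemperateGrowth),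
      Complex.real_smul]
    ring
  have parts := integral_bilinear_hasLineDerivAt_right_eq_neg_left_of_integrable (μ := volume)
    (B := ContinuousLinearMap.mul ℝ ℂ) (v := m) inner_int (hh.integrable_mul ha (∂_{m} u))
    (hh.integrable_mul ha u) (fun y _ => hasLineDerivAt_comp_regNorm ha m y hd)
    (fun y _ => by
      rw [SchwartzMap.lineDerivOp_apply_eq_fderiv]
      exact (u.hasFDerivAt y).hasLineDerivAt m)
  simp only [ContinuousLinearMap.mul_apply'] at parts
  rw [parts]
  congr 2 with y
  rw [SchwartzMap.smulLeftCLM_apply_apply (by fun_prop), Complex.real_smul]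
  ring

theorem integral_regNorm_mul_sum_lineDeriv {ι : Type*} [Fintype ι] (b : ι → E) (ha : 0 < a)
    (hh : IsRadialProfile h) (hh' : IsRadialProfile h')
    (hd : ∀ r, 0 < r → HasDerivAt h (r * h' r) r) (v : ι → 𝓢(E, ℂ)) :
    ∫ y, h (regNorm a y) * (∑ i, ∂_{b i} (v i)) y
      = -∫ y, h' (regNorm a y) * (∑ i, SchwartzMap.smulLeftCLM ℂ (⟪b i, ·⟫_ℝ) (v i)) y := by
  simp only [sum_apply, Finset.mul_sum]
  rw [integral_finsetSum _ fun i _ => hh.integrable_mul ha _,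
    integral_finsetSum _ fun i _ => hh'.integrable_mul ha _, ← Finset.sum_neg_distrib]
  exact Finset.sum_congr rfl fun i _ => integral_regNorm_mul_lineDeriv ha hh hh' hd (b i) (v i)

theorem integral_regNorm_mul_laplacian (ha : 0 < a) (hh : IsRadialProfile h)
    (hh' : IsRadialProfile h') (hd : ∀ r, 0 < r → HasDerivAt h (r * h' r) r) (u : 𝓢(E, ℂ)) :
    ∫ y, h (regNorm a y) * (Δ u) y = -∫ y, h' (regNorm a y) * euler u y := by
  set b := stdOrthonormalBasis ℝ E
  rw [SchwartzMap.laplacian_eq_sum b u,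
    integral_regNorm_mul_sum_lineDeriv b ha hh hh' hd fun i => ∂_{b i} u]
  have inner_growth (i) : (⟪b i, ·⟫_ℝ).HasTemperateGrowth := by fun_prop
  simp only [sum_apply, SchwartzMap.smulLeftCLM_apply_apply (inner_growth _),
    sum_inner_smul_lineDeriv b u]

theorem integral_regNorm_mul_euler (ha : 0 < a) (hh : IsRadialProfile h)
    (hh' : IsRadialProfile h') (hd : ∀ r, 0 < r → HasDerivAt h (r * h' r) r) (u : 𝓢(E, ℂ)) :
    ∫ y, h (regNorm a y) * euler u y = -∫ y, (Module.finrank ℝ E * h (regNorm a y)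
      + ‖y‖ ^ 2 * h' (regNorm a y)) * u y := by
  set b := stdOrthonormalBasis ℝ E
  have inner_growth (i) : (⟪b i, ·⟫_ℝ).HasTemperateGrowth := by fun_prop
  set v : Fin (Module.finrank ℝ E) → 𝓢(E, ℂ) := fun i => SchwartzMap.smulLeftCLM ℂ (⟪b i, ·⟫_ℝ) u
    with hv
  have divergence (y : E) : (∑ i, ∂_{b i} (v i)) y = euler u y + Module.finrank ℝ E * u y := by
    have leibniz (i) : (∂_{b i} (v i)) y = ⟪b i, y⟫_ℝ • (∂_{b i} u) y + u y := by
      have hline (x : E) : HasLineDerivAt ℝ (⟪b i, ·⟫_ℝ) 1 x (b i) := by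
        simpa [b.norm_eq_one] using (innerSL ℝ (b i)).hasFDerivAt (x := x) |>.hasLineDerivAt (b i)
      rw [hv, lineDeriv_smulLeftCLM (inner_growth i) hline, one_smul]
    simp only [sum_apply, leibniz, Finset.sum_add_distrib, sum_inner_smul_lineDeriv b u,
      Finset.sum_const, Finset.card_univ, Fintype.card_fin, nsmul_eq_mul]
  have radial (y : E) :
      (∑ i, SchwartzMap.smulLeftCLM ℂ (⟪b i, ·⟫_ℝ) (v i)) y = ‖y‖ ^ 2 * u y := by
    simp only [hv, sum_apply, SchwartzMap.smulLeftCLM_apply_apply (inner_growth _)]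
    simp only [smul_smul, ← Finset.sum_smul, ← sq, b.sum_sq_inner_right]
    simp
  have parts := integral_regNorm_mul_sum_lineDeriv b ha hh hh' hd v
  have hu := (hh.integrable_mul ha u).const_mul (Module.finrank ℝ E : ℂ)
  calc ∫ y, h (regNorm a y) * euler u y
      = ∫ y, (h (regNorm a y) * (∑ i, ∂_{b i} (v i)) y
          - Module.finrank ℝ E * (h (regNorm a y) * u y)) := by
        congr with y; rw [divergence]; ring
    _ = -∫ y, (Module.finrank ℝ E * (h (regNorm a y) * u y)
          + h' (regNorm a y) * (∑ i, SchwartzMap.smulLeftCLM ℂ (⟪b i, ·⟫_ℝ) (v i)) y) := by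
        rw [integral_sub (hh.integrable_mul ha _) hu, parts,
          integral_add hu (hh'.integrable_mul ha _)]
        ring
    _ = _ := by
        congr! 3 with y
        rw [radial]; ring

end RadialConvolution

section GreenRepresentation

open Complex (I)

/-- The radial profile `e^(izr) / (4πr)` of the outgoing kernel of `-Δ - z²`. -/
def outgoingProfile (z : ℂ) (r : ℝ) : ℂ := Complex.exp (I * z * r) / (4 * Real.pi * r)

/-- The derivative of `outgoingProfile`, divided by `r`. -/
def outgoingProfileDeriv (z : ℂ) (r : ℝ) : ℂ :=
  Complex.exp (I * z * r) / (4 * Real.pi) * (I * z / r ^ 2 - 1 / r ^ 3)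

/-- The derivative of `outgoingProfileDeriv`, divided by `r`. -/
def outgoingProfileDeriv₂ (z : ℂ) (r : ℝ) : ℂ :=
  Complex.exp (I * z * r) / (4 * Real.pi) * (3 / r ^ 5 - 3 * I * z / r ^ 4 - z ^ 2 / r ^ 3)

theorem hasDerivAt_outgoingProfile (z : ℂ) {r : ℝ} (hr : 0 < r) :
    HasDerivAt (outgoingProfile z) (r * outgoingProfileDeriv z r) r := by
  have : (r : ℂ) ≠ 0 := by exact_mod_cast hr.ne'
  have : (Real.pi : ℂ) ≠ 0 := by exact_mod_cast Real.pi_ne_zero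
  have quotient := (((hasDerivAt_id (r : ℂ)).const_mul (I * z)).cexp).div
    ((hasDerivAt_id (r : ℂ)).const_mul (4 * Real.pi : ℂ)) (by simp [*])
  convert! quotient.comp_ofReal using 1
  simp only [outgoingProfileDeriv, id]
  field_simp

theorem hasDerivAt_outgoingProfileDeriv (z : ℂ) {r : ℝ} (hr : 0 < r) :
    HasDerivAt (outgoingProfileDeriv z) (r * outgoingProfileDeriv₂ z r) r := by
  have hr₀ : (r : ℂ) ≠ 0 := by exact_mod_cast hr.ne'
  have inv_pow (c : ℂ) (n : ℕ) := (hasDerivAt_const (r : ℂ) c).div (hasDerivAt_pow n (r : ℂ))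
    (pow_ne_zero n hr₀)
  have product := (((hasDerivAt_id (r : ℂ)).const_mul (I * z)).cexp.div_const (4 * Real.pi)).mul
    ((inv_pow (I * z) 2).sub (inv_pow 1 3))
  convert! product.comp_ofReal using 1
  have : (Real.pi : ℂ) ≠ 0 := by exact_mod_cast Real.pi_ne_zero
  simp only [outgoingProfileDeriv₂, id, Pi.sub_apply, Pi.div_apply]
  push_cast
  field_simp
  linear_combination -(r ^ 2 * z ^ 2 * Complex.I_sq)

theorem three_mul_outgoingProfileDeriv_add (z : ℂ) {r : ℝ} (hr : 0 < r) :
    3 * outgoingProfileDeriv z r + r ^ 2 * outgoingProfileDeriv₂ z r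
      = -z ^ 2 * outgoingProfile z r := by
  have : (r : ℂ) ≠ 0 := by exact_mod_cast hr.ne'
  have : (Real.pi : ℂ) ≠ 0 := by exact_mod_cast Real.pi_ne_zero
  unfold outgoingProfile outgoingProfileDeriv outgoingProfileDeriv₂
  field_simp
  ring

theorem norm_exp_div_four_pi (z : ℂ) (r : ℝ) :
    ‖Complex.exp (I * z * r) / (4 * Real.pi)‖ = Real.exp (-(z.im * r)) / (4 * Real.pi) := by
  rw [norm_div, Complex.norm_exp]
  congr 1
  · simp
  · simp [abs_of_pos Real.pi_pos]

theorem norm_exp_div_four_pi_le {z : ℂ} (hz : 0 ≤ z.im) {r : ℝ} (hr : 0 ≤ r) :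
    ‖Complex.exp (I * z * r) / (4 * Real.pi)‖ ≤ (4 * Real.pi)⁻¹ := by
  rw [norm_exp_div_four_pi, div_eq_mul_inv]
  exact mul_le_of_le_one_left (by positivity)
    (Real.exp_le_one_iff.2 (neg_nonpos.2 (mul_nonneg hz hr)))

theorem norm_outgoingProfile_le {z : ℂ} (hz : 0 ≤ z.im) {r : ℝ} (hr : 0 ≤ r) :
    ‖outgoingProfile z r‖ ≤ (4 * Real.pi)⁻¹ * r⁻¹ := by
  rw [outgoingProfile, ← div_div, norm_div, Complex.norm_real, Real.norm_of_nonneg hr,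
    div_eq_mul_inv]
  gcongr
  exact norm_exp_div_four_pi_le hz hr

theorem isRadialProfile_exp_div_four_pi {z : ℂ} (hz : 0 ≤ z.im) :
    IsRadialProfile (fun r => Complex.exp (I * z * r) / (4 * Real.pi)) where
  continuousOn := by fun_prop
  bounded _ ha := ⟨_, fun _ hr => norm_exp_div_four_pi_le hz (ha.le.trans hr)⟩

theorem isRadialProfile_outgoingProfile {z : ℂ} (hz : 0 ≤ z.im) :
    IsRadialProfile (outgoingProfile z) := by
  convert! (isRadialProfile_exp_div_four_pi hz).mul (.const_div_pow 1 1) using 1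
  ext r
  simp [outgoingProfile, div_eq_mul_inv]
  ring

theorem isRadialProfile_outgoingProfileDeriv {z : ℂ} (hz : 0 ≤ z.im) :
    IsRadialProfile (outgoingProfileDeriv z) :=
  (isRadialProfile_exp_div_four_pi hz).mul ((IsRadialProfile.const_div_pow _ 2).sub
    (.const_div_pow 1 3))

theorem isRadialProfile_outgoingProfileDeriv₂ {z : ℂ} (hz : 0 ≤ z.im) :
    IsRadialProfile (outgoingProfileDeriv₂ z) :=
  (isRadialProfile_exp_div_four_pi hz).mul (((IsRadialProfile.const_div_pow 3 5).sub
    (.const_div_pow _ 4)).sub (.const_div_pow _ 3))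

theorem integral_outgoingProfile_mul_helmholtz {z : ℂ} (hz : 0 ≤ z.im) {a : ℝ} (ha : 0 < a)
    (u : 𝓢(R3, ℂ)) :
    ∫ y, outgoingProfile z (regNorm a y) * helmholtz z u y =
      ∫ y, a ^ 2 * outgoingProfileDeriv₂ z (regNorm a y) * u y := by
  have profile := isRadialProfile_outgoingProfile hz
  have profile' := isRadialProfile_outgoingProfileDeriv hz
  have profile'' := isRadialProfile_outgoingProfileDeriv₂ hz
  have laplacian := integral_regNorm_mul_laplacian ha profile profile'
    (fun _ => hasDerivAt_outgoingProfile z) u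
  rw [integral_regNorm_mul_euler ha profile' profile''
    (fun _ => hasDerivAt_outgoingProfileDeriv z) u, neg_neg] at laplacian
  have radial (y : R3) : (Module.finrank ℝ R3 * outgoingProfileDeriv z (regNorm a y)
      + ‖y‖ ^ 2 * outgoingProfileDeriv₂ z (regNorm a y)) * u y
      = -z ^ 2 * (outgoingProfile z (regNorm a y) * u y)
        - a ^ 2 * (outgoingProfileDeriv₂ z (regNorm a y) * u y) := by
    have identity := three_mul_outgoingProfileDeriv_add z (regNorm_pos ha y)
    rw [← Complex.ofReal_pow, regNorm_sq] at identity
    simp only [finrank_euclideanSpace, Fintype.card_fin]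
    push_cast at identity ⊢
    linear_combination (u y) * identity
  have int_u := profile.integrable_mul ha u
  simp only [radial] at laplacian
  rw [integral_sub (int_u.const_mul _) ((profile''.integrable_mul ha u).const_mul _),
    integral_const_mul, integral_const_mul] at laplacian
  calc ∫ y, outgoingProfile z (regNorm a y) * helmholtz z u y
      = ∫ y, -(outgoingProfile z (regNorm a y) * (Δ u) y)
          - z ^ 2 * (outgoingProfile z (regNorm a y) * u y) := by
        congr with y
        simp only [helmholtz, sub_apply, neg_apply, smul_apply, smul_eq_mul]
        ring
    _ = a ^ 2 * ∫ y, outgoingProfileDeriv₂ z (regNorm a y) * u y := by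
        rw [integral_sub (profile.integrable_mul ha _).fun_neg (int_u.const_mul _), integral_neg,
          integral_const_mul, laplacian]
        ring
    _ = _ := by simp only [mul_assoc, integral_const_mul]

/-- The source `a⁵ G''(a⟨w⟩)` left by the regularized kernel, at the scale `a` of the
regularization; `G''` is `outgoingProfileDeriv₂ z`. -/
def scaledSource (z : ℂ) (a : ℝ) (w : R3) : ℂ :=
  Complex.exp (I * z * (a * bracket 1 w : ℝ)) / (4 * Real.pi) *
    (3 * bracket (-5) w - 3 * I * z * a * bracket (-4) w - z ^ 2 * a ^ 2 * bracket (-3) w)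

theorem pow_five_mul_outgoingProfileDeriv₂ (z : ℂ) {a : ℝ} (ha : 0 < a) (w : R3) :
    (a : ℂ) ^ 5 * outgoingProfileDeriv₂ z (a * bracket 1 w) = scaledSource z a w := by
  have hpow (n : ℕ) : bracket (-n : ℝ) w = (bracket 1 w ^ n)⁻¹ := by
    rw [bracket_neg, bracket, bracket, ← Real.rpow_natCast _ n, ← Real.rpow_mul (by positivity)]
    ring_nf
  have h₃ := hpow 3
  have h₄ := hpow 4
  have h₅ := hpow 5
  push_cast at h₃ h₄ h₅
  have : (a : ℂ) ≠ 0 := by exact_mod_cast ha.ne'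
  have : (bracket 1 w : ℂ) ≠ 0 := by exact_mod_cast (bracket_pos 1 w).ne'
  have : (Real.pi : ℂ) ≠ 0 := by exact_mod_cast Real.pi_ne_zero
  unfold outgoingProfileDeriv₂ scaledSource
  rw [h₃, h₄, h₅]
  push_cast
  field_simp

theorem integral_outgoingProfileDeriv₂_eq_scaledSource (z : ℂ) {a : ℝ} (ha : 0 < a)
    (u : 𝓢(R3, ℂ)) :
    ∫ y, a ^ 2 * outgoingProfileDeriv₂ z (regNorm a y) * u y
      = ∫ w, scaledSource z a w * u (a • w) := by
  have scaling := Measure.integral_comp_smul (volume : Measure R3)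
    (fun y => a ^ 2 * outgoingProfileDeriv₂ z (regNorm a y) * u y) a
  have habs : |(a ^ Module.finrank ℝ R3)⁻¹| = (a ^ 3)⁻¹ := by
    rw [abs_of_pos (by positivity)]; simp
  rw [habs, eq_inv_smul_iff₀ (by positivity)] at scaling
  rw [← scaling, Complex.real_smul, ← integral_const_mul]
  congr with w
  rw [regNorm_smul ha, ← pow_five_mul_outgoingProfileDeriv₂ z ha]
  push_cast
  ring

theorem norm_exp_div_four_pi_mul_le {z : ℂ} (hz : 0 < z.im) {r : ℝ} (hr : 0 ≤ r) :
    ‖Complex.exp (I * z * r) / (4 * Real.pi)‖ * r ≤ z.im⁻¹ := by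
  have decay : z.im * r * Real.exp (-(z.im * r)) ≤ 1 := by
    rw [Real.exp_neg, ← div_eq_mul_inv]
    exact div_le_one_of_le₀ (by linarith [Real.add_one_le_exp (z.im * r)]) (Real.exp_pos _).le
  have hpi : (4 * Real.pi)⁻¹ ≤ 1 := inv_le_one_of_one_le₀ (by linarith [Real.pi_gt_three])
  rw [norm_exp_div_four_pi]
  calc _ = (4 * Real.pi)⁻¹ * (z.im * r * Real.exp (-(z.im * r))) * z.im⁻¹ := by field_simp
    _ ≤ 1 * 1 * z.im⁻¹ := by gcongr
    _ = _ := by ring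

theorem norm_scaledSource_le {z : ℂ} (hz : 0 < z.im) {a : ℝ} (ha : 0 < a) (ha' : a ≤ 1) (w : R3) :
    ‖scaledSource z a w‖ ≤ (3 + 3 * ‖z‖ + ‖z‖ ^ 2 / z.im) * bracket (-4) w := by
  have h₁ := bracket_pos 1 w
  have h₄ := bracket_pos (-4) w
  have h₅ := bracket_pos (-5) w
  have h₄₅ : bracket (-5) w ≤ bracket (-4) w := bracket_mono (by norm_num) w
  have h₃ : bracket (-3) w = bracket 1 w * bracket (-4) w := by rw [← bracket_add]; norm_num
  have hE : ‖Complex.exp (I * z * (a * bracket 1 w : ℝ)) / (4 * Real.pi)‖ ≤ 1 :=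
    (norm_exp_div_four_pi_le hz.le (by positivity)).trans
      (inv_le_one_of_one_le₀ (by linarith [Real.pi_gt_three]))
  have hEr := norm_exp_div_four_pi_mul_le hz (by positivity : 0 ≤ a * bracket 1 w)
  rw [scaledSource, norm_mul]
  set E := ‖Complex.exp (I * z * (a * bracket 1 w : ℝ)) / (4 * Real.pi)‖
  have triangle : ‖3 * (bracket (-5) w : ℂ) - 3 * I * z * a * bracket (-4) w
      - z ^ 2 * a ^ 2 * bracket (-3) w‖ ≤ 3 * bracket (-5) w + 3 * ‖z‖ * a * bracket (-4) w
        + ‖z‖ ^ 2 * a ^ 2 * (bracket 1 w * bracket (-4) w) := by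
    refine (norm_sub_le _ _).trans (add_le_add ((norm_sub_le _ _).trans (add_le_add ?_ ?_)) ?_)
    · simp [abs_of_pos h₅]
    · simp [abs_of_pos h₄, abs_of_pos ha]
    · simp [h₃, abs_of_pos h₄, abs_of_pos ha, abs_of_pos h₁]
  calc _ ≤ E * _ := mul_le_mul_of_nonneg_left triangle (norm_nonneg _)
    _ = E * (3 * bracket (-5) w + 3 * ‖z‖ * a * bracket (-4) w)
        + ‖z‖ ^ 2 * a * (E * (a * bracket 1 w)) * bracket (-4) w := by ring
    _ ≤ 1 * (3 * bracket (-4) w + 3 * ‖z‖ * 1 * bracket (-4) w)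
        + ‖z‖ ^ 2 * 1 * z.im⁻¹ * bracket (-4) w := by gcongr
    _ = _ := by ring

theorem tendsto_integral_scaledSource {z : ℂ} (hz : 0 < z.im) (u : 𝓢(R3, ℂ)) :
    Tendsto (fun a => ∫ w, scaledSource z a w * u (a • w)) (𝓝[>] 0) (𝓝 (u 0)) := by
  have limit : ∫ w : R3, (3 / (4 * Real.pi) * (bracket (-5) w : ℂ)) * u 0 = u 0 := by
    rw [integral_mul_const, integral_const_mul, integral_complex_ofReal,
      integral_bracket_neg_five]
    have : (Real.pi : ℂ) ≠ 0 := by exact_mod_cast Real.pi_ne_zero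
    push_cast
    field_simp
  have := u.continuous
  obtain ⟨M, -, hM⟩ := exists_norm_le_mul_bracket u 0
  rw [← limit]
  refine tendsto_integral_filter_of_dominated_convergence
    (fun w => (3 + 3 * ‖z‖ + ‖z‖ ^ 2 / z.im) * bracket (-4) w * M) (.of_forall fun a => ?_) ?_
    (((integrable_bracket volume (by norm_num)).const_mul _).mul_const _) (.of_forall fun w => ?_)
  · unfold scaledSource
    exact Continuous.aestronglyMeasurable (by fun_prop)
  · filter_upwards [Ioc_mem_nhdsGT zero_lt_one] with a ha
    refine .of_forall fun w => ?_
    have hu := hM (a • w)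
    rw [neg_zero, bracket_zero, mul_one] at hu
    have hs := norm_scaledSource_le hz ha.1 ha.2 w
    rw [norm_mul]
    exact mul_le_mul hs hu (norm_nonneg _) ((norm_nonneg _).trans hs)
  · have hcont : Continuous (fun a : ℝ => scaledSource z a w * u (a • w)) := by
      unfold scaledSource
      fun_prop
    convert! (hcont.tendsto 0).mono_left nhdsWithin_le_nhds using 2
    simp only [scaledSource, Complex.ofReal_zero, zero_mul, mul_zero, sub_zero, zero_smul,
      Complex.exp_zero, zero_pow two_ne_zero]
    ring

theorem tendsto_integral_outgoingProfile {z : ℂ} (hz : 0 ≤ z.im) (f : 𝓢(R3, ℂ)) :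
    Tendsto (fun a => ∫ y, outgoingProfile z (regNorm a y) * f y) (𝓝[>] 0)
      (𝓝 (∫ y, outgoingProfile z ‖y‖ * f y)) := by
  obtain ⟨C, -, hC⟩ := exists_integral_inv_norm_mul_schwartz_le f
  have ae_ne : ∀ᵐ y : R3, y ≠ 0 := by simp [ae_iff]
  refine tendsto_integral_filter_of_dominated_convergence
    (fun y => (4 * Real.pi)⁻¹ * (‖y - 0‖⁻¹ * ‖f y‖)) ?_ ?_ ((hC 0).1.const_mul _) ?_
  · filter_upwards [self_mem_nhdsWithin] with a ha
    exact ((isRadialProfile_outgoingProfile hz).integrable_mul ha f).aestronglyMeasurable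
  · filter_upwards [self_mem_nhdsWithin] with a ha
    filter_upwards [ae_ne] with y hy
    have := norm_pos_iff.2 hy
    rw [norm_mul, sub_zero, ← mul_assoc]
    gcongr
    refine (norm_outgoingProfile_le hz (regNorm_pos ha y).le).trans ?_
    gcongr
    exact norm_le_regNorm a y
  · filter_upwards [ae_ne] with y hy
    have hreg : Tendsto (fun a => regNorm a y) (𝓝[>] 0) (𝓝 ‖y‖) := by
      have hcont : Continuous (fun a => regNorm a y) := by unfold regNorm; fun_prop
      convert! (hcont.tendsto 0).mono_left nhdsWithin_le_nhds using 2
      simp [regNorm]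
    exact ((hasDerivAt_outgoingProfile z (norm_pos_iff.2 hy)).continuousAt.tendsto.comp
      hreg).mul_const _

theorem integral_outgoingProfile_norm_mul_helmholtz {z : ℂ} (hz : 0 < z.im) (u : 𝓢(R3, ℂ)) :
    ∫ y, outgoingProfile z ‖y‖ * helmholtz z u y = u 0 := by
  refine tendsto_nhds_unique (tendsto_integral_outgoingProfile hz.le _) ?_
  refine (tendsto_integral_scaledSource hz u).congr' ?_
  filter_upwards [self_mem_nhdsWithin] with a ha
  rw [integral_outgoingProfile_mul_helmholtz hz.le ha,
    integral_outgoingProfileDeriv₂_eq_scaledSource z ha]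

theorem lineDeriv_compSubConstCLM {E F : Type*} [NormedAddCommGroup E] [NormedSpace ℝ E]
    [NormedAddCommGroup F] [NormedSpace ℝ F] [NormedSpace ℂ F] (m x : E) (u : 𝓢(E, F)) :
    ∂_{m} (SchwartzMap.compSubConstCLM ℂ x u) = SchwartzMap.compSubConstCLM ℂ x (∂_{m} u) := by
  ext y
  simp only [SchwartzMap.lineDerivOp_apply_eq_fderiv, SchwartzMap.compSubConstCLM_apply]
  rw [← fderiv_comp_sub]
  rfl

theorem green_representation {z : ℂ} (hz : 0 < z.im) (u : 𝓢(R3, ℂ)) (x : R3) :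
    ∫ y, outgoingProfile z ‖x - y‖ * helmholtz z u y = u x := by
  have translate : helmholtz z (SchwartzMap.compSubConstCLM ℂ (-x) u) =
      SchwartzMap.compSubConstCLM ℂ (-x) (helmholtz z u) := by
    simp only [helmholtz, SchwartzMap.laplacian_eq_sum (stdOrthonormalBasis ℝ R3),
      lineDeriv_compSubConstCLM, map_sub, map_neg, map_sum, map_smul]
  have green := integral_outgoingProfile_norm_mul_helmholtz hz
    (SchwartzMap.compSubConstCLM ℂ (-x) u)
  simp only [translate, SchwartzMap.compSubConstCLM_apply, sub_neg_eq_add, zero_add] at green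
  rw [← green, ← integral_add_right_eq_self _ x]
  congr with y
  rw [sub_add_cancel_right, norm_neg]

end GreenRepresentation

section SchwartzL2

variable {E F F' : Type*} [NormedAddCommGroup E] [InnerProductSpace ℝ E] [FiniteDimensional ℝ E]
  [MeasurableSpace E] [BorelSpace E]

section NormedSpace

variable [NormedAddCommGroup F] [NormedSpace ℝ F] [NormedAddCommGroup F'] [NormedSpace ℝ F']
  {f : 𝓢(E, F)} {c : ℝ}

theorem norm_toLp_le_mul_norm_toLp {g : 𝓢(E, F')} (h : ∀ x, ‖f x‖ ≤ c * ‖g x‖) :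
    ‖f.toLp 2‖ ≤ c * ‖g.toLp 2‖ := by
  refine Lp.norm_le_mul_norm_of_ae_le_mul ?_
  filter_upwards [f.coeFn_toLp 2, g.coeFn_toLp 2] with x hf hg
  simpa only [hf, hg] using h x

theorem norm_toLp_add_le (f g : 𝓢(E, F)) : ‖(f + g).toLp 2‖ ≤ ‖f.toLp 2‖ + ‖g.toLp 2‖ := by
  rw [show (f + g).toLp 2 volume = f.toLp 2 volume + g.toLp 2 volume from
    map_add (SchwartzMap.toLpCLM ℝ F 2 volume) f g]
  exact norm_add_le _ _

theorem norm_toLp_two_sq (f : 𝓢(E, F)) : ‖f.toLp 2‖ ^ 2 = ∫ x, ‖f x‖ ^ 2 := by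
  rw [SchwartzMap.norm_toLp' (by norm_num) (by norm_num)]
  simp only [ENNReal.toReal_ofNat, Real.rpow_ofNat]
  exact_mod_cast Real.rpow_inv_natCast_pow (integral_nonneg fun x => sq_nonneg ‖f x‖) two_ne_zero

theorem norm_toLp_smulLeftCLM_le {𝕜 : Type*} [RCLike 𝕜] [NormedSpace 𝕜 F]
    {g : E → 𝕜} (hg : g.HasTemperateGrowth) (h : ∀ x, ‖g x‖ ≤ c) (f : 𝓢(E, F)) :
    ‖(SchwartzMap.smulLeftCLM F g f).toLp 2‖ ≤ c * ‖f.toLp 2‖ := by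
  refine norm_toLp_le_mul_norm_toLp fun x => ?_
  rw [SchwartzMap.smulLeftCLM_apply_apply hg, norm_smul]
  gcongr
  exact h x

end NormedSpace

theorem norm_toLp_fourierMultiplierCLM_le [NormedAddCommGroup F] [InnerProductSpace ℂ F]
    [CompleteSpace F] {g : E → ℂ} (hg : g.HasTemperateGrowth) {c : ℝ} (h : ∀ ξ, ‖g ξ‖ ≤ c)
    (f : 𝓢(E, F)) :
    ‖(SchwartzMap.fourierMultiplierCLM F g f).toLp 2‖ ≤ c * ‖f.toLp 2‖ := by
  rw [← SchwartzMap.norm_fourier_toL2_eq, ← SchwartzMap.norm_fourier_toL2_eq f,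
    SchwartzMap.fourierMultiplierCLM_apply, FourierTransform.fourier_fourierInv_eq]
  exact norm_toLp_smulLeftCLM_le hg h _

theorem fourierMultiplierCLM_sub [NormedAddCommGroup F] [NormedSpace ℂ F] {g h : E → ℂ}
    (hg : g.HasTemperateGrowth) (hh : h.HasTemperateGrowth) :
    SchwartzMap.fourierMultiplierCLM F (g - h) =
      SchwartzMap.fourierMultiplierCLM F g - SchwartzMap.fourierMultiplierCLM F h := by
  simp only [SchwartzMap.fourierMultiplierCLM, SchwartzMap.smulLeftCLM_sub hg hh,
    ContinuousLinearMap.sub_comp, ContinuousLinearMap.comp_sub]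

end SchwartzL2

section FreeResolvent

open Complex (I)

theorem hasTemperateGrowth_inv_sub {c : ℂ} (hc : c.im ≠ 0) :
    (fun t : ℝ => ((t : ℂ) - c)⁻¹).HasTemperateGrowth := by
  have rationalized : (fun t : ℝ => ((t : ℂ) - c)⁻¹) = fun t : ℝ =>
      ((t : ℂ) - star c) * (((c.im ^ 2)⁻¹ * bracket (-2) (c.im⁻¹ * (t - c.re)) : ℝ) : ℂ) := by
    ext t
    have hsq : Complex.normSq (t - c) = c.im ^ 2 * bracket 2 (c.im⁻¹ * (t - c.re)) := by
      rw [bracket_two, Real.norm_eq_abs, sq_abs, Complex.normSq_apply]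
      simp only [Complex.sub_re, Complex.sub_im, Complex.ofReal_re, Complex.ofReal_im]
      field_simp
      ring
    rw [Complex.inv_def, hsq, mul_inv, bracket_neg]
    simp
  rw [rationalized]
  fun_prop

/-- The symbol `1 / (|2πξ|² - z²)` of the resolvent of `-Δ`. -/
def resolventSymbol (z : ℂ) (ξ : R3) : ℂ := (((‖(2 * Real.pi) • ξ‖ ^ 2 : ℝ) : ℂ) - z ^ 2)⁻¹

/-- The free resolvent `(-Δ - z²)⁻¹` on Schwartz functions, for `z²` off the real axis. -/
def freeResolvent (z : ℂ) : 𝓢(R3, ℂ) →L[ℂ] 𝓢(R3, ℂ) :=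
  SchwartzMap.fourierMultiplierCLM ℂ (resolventSymbol z)

theorem norm_const_smul_sq_hasTemperateGrowth (c : ℝ) :
    (fun ξ : R3 => ‖c • ξ‖ ^ 2).HasTemperateGrowth := by
  simp only [norm_smul, mul_pow]
  fun_prop

theorem resolventSymbol_hasTemperateGrowth {z : ℂ} (hz : (z ^ 2).im ≠ 0) :
    (resolventSymbol z).HasTemperateGrowth :=
  (hasTemperateGrowth_inv_sub hz).comp (norm_const_smul_sq_hasTemperateGrowth _)

theorem helmholtz_eq_fourierMultiplierCLM (z : ℂ) (u : 𝓢(R3, ℂ)) :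
    helmholtz z u = SchwartzMap.fourierMultiplierCLM ℂ
      (fun ξ : R3 => ((‖(2 * Real.pi) • ξ‖ ^ 2 : ℝ) : ℂ) - z ^ 2) u := by
  have symbol : (fun ξ : R3 => ((‖(2 * Real.pi) • ξ‖ ^ 2 : ℝ) : ℂ) - z ^ 2) =
      ((2 * Real.pi) ^ 2 : ℂ) • (fun ξ : R3 => ((‖ξ‖ ^ 2 : ℝ) : ℂ)) - fun _ => z ^ 2 := by
    ext ξ
    simp [norm_smul, mul_pow, sq_abs]
  rw [symbol, fourierMultiplierCLM_sub (by fun_prop) (by fun_prop),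
    SchwartzMap.fourierMultiplierCLM_smul (by fun_prop), SchwartzMap.fourierMultiplierCLM_const,
    helmholtz, SchwartzMap.laplacian_eq_fourierMultiplierCLM,
    ← SchwartzMap.fourierMultiplierCLM_ofReal ℂ (by fun_prop)]
  ext x
  simp

theorem helmholtzSymbol_hasTemperateGrowth (z : ℂ) :
    (fun ξ : R3 => ((‖(2 * Real.pi) • ξ‖ ^ 2 : ℝ) : ℂ) - z ^ 2).HasTemperateGrowth := by
  have := norm_const_smul_sq_hasTemperateGrowth (2 * Real.pi)
  fun_prop

theorem helmholtz_freeResolvent {z : ℂ} (hz : (z ^ 2).im ≠ 0) (f : 𝓢(R3, ℂ)) :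
    helmholtz z (freeResolvent z f) = f := by
  rw [helmholtz_eq_fourierMultiplierCLM, freeResolvent,
    SchwartzMap.fourierMultiplierCLM_fourierMultiplierCLM_apply
      (helmholtzSymbol_hasTemperateGrowth z) (resolventSymbol_hasTemperateGrowth hz)]
  have cancel : ((fun ξ : R3 => ((‖(2 * Real.pi) • ξ‖ ^ 2 : ℝ) : ℂ) - z ^ 2) * resolventSymbol z)
      = fun _ => 1 := by
    ext ξ
    refine mul_inv_cancel₀ fun h => hz ?_
    rw [← sub_eq_zero.1 h, Complex.ofReal_im]
  rw [cancel, SchwartzMap.fourierMultiplierCLM_const, one_smul, ContinuousLinearMap.id_apply]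

theorem im_sq_ne_zero {k η : ℝ} (hk : 0 < k) (hη : 0 < η) : ((k + η * I : ℂ) ^ 2).im ≠ 0 := by
  have h : ((k + η * I : ℂ) ^ 2).im = 2 * k * η := by simp [sq]; ring
  rw [h]
  positivity

theorem freeResolvent_apply {k η : ℝ} (hk : 0 < k) (hη : 0 < η) (f : 𝓢(R3, ℂ)) (x : R3) :
    freeResolvent (k + η * I) f x = ∫ y, outgoingProfile (k + η * I) ‖x - y‖ * f y := by
  rw [← green_representation (z := k + η * I) (by simpa using hη),
    helmholtz_freeResolvent (im_sq_ne_zero hk hη)]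

end FreeResolvent

section BesselSymbols

theorem abs_rpow_sub_one_le {s r : ℝ} (hs : 0 ≤ s) (hs' : s ≤ 1) (hr : 0 ≤ r) :
    |r ^ s - 1| ≤ |r - 1| := by
  rcases le_total r 1 with h | h
  · rw [abs_of_nonpos (sub_nonpos.2 (Real.rpow_le_one hr h hs)), abs_of_nonpos (sub_nonpos.2 h)]
    linarith [Real.self_le_rpow_of_le_one hr h hs']
  · rw [abs_of_nonneg (sub_nonneg.2 (Real.one_le_rpow h hs)), abs_of_nonneg (sub_nonneg.2 h)]
    linarith [Real.rpow_le_self_of_one_le h hs']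

theorem abs_rpow_sub_rpow_le {s x y : ℝ} (hs : 0 ≤ s) (hs' : s ≤ 1) (hx : 0 ≤ x) (hy : 0 < y) :
    |x ^ s - y ^ s| ≤ y ^ (s - 1) * |x - y| := by
  have pow_factor : x ^ s - y ^ s = y ^ s * ((x / y) ^ s - 1) := by
    rw [Real.div_rpow hx hy.le]
    field_simp
  have factor : x - y = y * (x / y - 1) := by field_simp
  rw [pow_factor, factor, abs_mul, abs_mul, abs_of_pos (Real.rpow_pos_of_pos hy s), abs_of_pos hy,
    ← mul_assoc, ← Real.rpow_add_one hy.ne', sub_add_cancel]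
  exact mul_le_mul_of_nonneg_left (abs_rpow_sub_one_le hs hs' (by positivity)) (by positivity)

theorem abs_sub_sq_le_two_mul_norm {k η : ℝ} (hk : 1 ≤ k) (hη : 0 ≤ η) (hη' : η ≤ 1) (t : ℝ) :
    |t - k ^ 2| ≤ 2 * ‖(t : ℂ) - (k + η * Complex.I) ^ 2‖ := by
  set w : ℂ := (t : ℂ) - (k + η * Complex.I) ^ 2 with hw
  have re_le : |t - k ^ 2 + η ^ 2| ≤ ‖w‖ := by
    convert Complex.abs_re_le_norm w using 2
    simp [hw, sq]
    ring
  have im_le : 2 * k * η ≤ ‖w‖ := by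
    refine (le_abs_self _).trans (Eq.trans_le ?_ (Complex.abs_im_le_norm w))
    rw [← abs_neg]
    congr 1
    simp [hw, sq]
    ring
  calc |t - k ^ 2| = |t - k ^ 2 + η ^ 2 - η ^ 2| := by ring_nf
    _ ≤ |t - k ^ 2 + η ^ 2| + η ^ 2 := (abs_sub _ _).trans_eq (by rw [abs_of_nonneg (sq_nonneg η)])
    _ ≤ 2 * ‖w‖ := by nlinarith

theorem norm_rpow_sub_rpow_mul_inv_le {s k η t : ℝ} (hs : 0 ≤ s) (hs' : s ≤ 1) (hk : 1 ≤ k)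
    (hη : 0 ≤ η) (hη' : η ≤ 1) (ht : 0 ≤ t) :
    ‖(((1 + t) ^ s - (1 + k ^ 2) ^ s : ℝ) : ℂ) * ((t : ℂ) - (k + η * Complex.I) ^ 2)⁻¹‖
      ≤ 2 * k ^ (2 * s - 2) := by
  have hk0 : 0 < k := by linarith
  have pow_le : (1 + k ^ 2) ^ (s - 1) ≤ k ^ (2 * s - 2) := by
    rw [show 2 * s - 2 = (2 : ℕ) * (s - 1) by push_cast; ring, Real.rpow_natCast_mul hk0.le]
    exact Real.rpow_le_rpow_of_nonpos (by positivity) (by linarith) (by linarith)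
  rw [norm_mul, norm_inv, Complex.norm_real, Real.norm_eq_abs, ← div_eq_mul_inv]
  refine div_le_of_le_mul₀ (norm_nonneg _) (by positivity) ?_
  calc |(1 + t) ^ s - (1 + k ^ 2) ^ s|
      ≤ (1 + k ^ 2) ^ (s - 1) * |1 + t - (1 + k ^ 2)| :=
        abs_rpow_sub_rpow_le hs hs' (by positivity) (by positivity)
    _ = (1 + k ^ 2) ^ (s - 1) * |t - k ^ 2| := by rw [add_sub_add_left_eq_sub]
    _ ≤ k ^ (2 * s - 2) * (2 * ‖(t : ℂ) - (k + η * Complex.I) ^ 2‖) := by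
        gcongr
        exact abs_sub_sq_le_two_mul_norm hk hη hη' t
    _ = _ := by ring

end BesselSymbols

section WeightedResolvent

open Complex (I)

/-- The operator `(I - Δ)^(s/2)` on Schwartz functions. -/
def schwartzBessel (s : ℝ) : 𝓢(R3, ℂ) →L[ℂ] 𝓢(R3, ℂ) :=
  SchwartzMap.fourierMultiplierCLM ℂ (laplaceSymbol s)

/-- Multiplication by `⟨x⟩^δ` on Schwartz functions. -/
def bracketMul (δ : ℝ) : 𝓢(R3, ℂ) →L[ℂ] 𝓢(R3, ℂ) :=
  SchwartzMap.smulLeftCLM ℂ (bracketPow δ)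

theorem bracketMul_apply (δ : ℝ) (f : 𝓢(R3, ℂ)) (x : R3) :
    bracketMul δ f x = (bracket δ x : ℂ) * f x :=
  SchwartzMap.smulLeftCLM_apply_apply (bracketPow_hasTemperateGrowth δ) f x

theorem bracketMul_neg_bracketMul (δ : ℝ) (f : 𝓢(R3, ℂ)) :
    bracketMul (-δ) (bracketMul δ f) = f := by
  ext x
  rw [bracketMul_apply, bracketMul_apply, ← mul_assoc, ← Complex.ofReal_mul, ← bracket_add,
    neg_add_cancel, bracket_zero, Complex.ofReal_one, one_mul]

theorem norm_toLp_bracketMul_sq (δ : ℝ) (f : 𝓢(R3, ℂ)) :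
    ‖(bracketMul δ f).toLp 2‖ ^ 2 = weightedInner (bracket (2 * δ)) f f := by
  rw [norm_toLp_two_sq, weightedInner_self]
  refine integral_congr_ae (ae_of_all _ fun x => ?_)
  simp only [bracketMul_apply, norm_mul, mul_pow, Complex.norm_of_nonneg (bracket_pos δ x).le,
    two_mul, bracket_add, sq (bracket δ x)]

theorem norm_toLp_bracketMul_le {δ : ℝ} (hδ : δ ≤ 0) (f : 𝓢(R3, ℂ)) :
    ‖(bracketMul δ f).toLp 2‖ ≤ ‖f.toLp 2‖ := by
  have h (x : R3) : ‖bracketPow δ x‖ ≤ 1 :=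
    (Complex.norm_of_nonneg (bracket_pos δ x).le).trans_le (bracket_le_one hδ x)
  simpa only [one_mul, bracketMul] using
    norm_toLp_smulLeftCLM_le (bracketPow_hasTemperateGrowth δ) h f

theorem schwartzBessel_schwartzBessel_neg (s : ℝ) (f : 𝓢(R3, ℂ)) :
    schwartzBessel s (schwartzBessel (-s) f) = f := by
  have cancel : laplaceSymbol s * laplaceSymbol (-s) = fun _ => 1 :=
    funext fun ξ => bracketPow_mul_neg s _
  rw [schwartzBessel, schwartzBessel, SchwartzMap.fourierMultiplierCLM_fourierMultiplierCLM_apply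
    (laplaceSymbol_hasTemperateGrowth s) (laplaceSymbol_hasTemperateGrowth (-s)), cancel,
    SchwartzMap.fourierMultiplierCLM_const, one_smul, ContinuousLinearMap.id_apply]

theorem schwartzBessel_freeResolvent_schwartzBessel_sub {z : ℂ} (hz : (z ^ 2).im ≠ 0) (s : ℝ)
    (c : ℂ) (f : 𝓢(R3, ℂ)) :
    schwartzBessel s (freeResolvent z (schwartzBessel s f)) - c • freeResolvent z f =
      SchwartzMap.fourierMultiplierCLM ℂ
        (laplaceSymbol s * (resolventSymbol z * laplaceSymbol s) - c • resolventSymbol z) f := by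
  have hJ := laplaceSymbol_hasTemperateGrowth s
  have hR := resolventSymbol_hasTemperateGrowth hz
  have hcR : (c • resolventSymbol z).HasTemperateGrowth :=
    (Function.HasTemperateGrowth.const c).mul hR
  rw [fourierMultiplierCLM_sub (hJ.mul (hR.mul hJ)) hcR, SchwartzMap.fourierMultiplierCLM_smul hR,
    sub_apply, smul_apply, schwartzBessel, freeResolvent,
    SchwartzMap.fourierMultiplierCLM_fourierMultiplierCLM_apply hR hJ,
    SchwartzMap.fourierMultiplierCLM_fourierMultiplierCLM_apply hJ (hR.mul hJ)]

theorem laplaceSymbol_mul_self (s : ℝ) (ξ : R3) :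
    laplaceSymbol s ξ * laplaceSymbol s ξ = (((1 + ‖(2 * Real.pi) • ξ‖ ^ 2) ^ s : ℝ) : ℂ) := by
  change (bracket s _ : ℂ) * (bracket s _ : ℂ) = _
  rw [← Complex.ofReal_mul, ← bracket_add, bracket, add_self_div_two]

-- Freezing `(I - Δ)^s` at `|ξ| = k` costs only a Fourier multiplier of size `k^(2s-2)`: its symbol
-- vanishes where that of the resolvent is singular.
theorem norm_toLp_schwartzBessel_freeResolvent_schwartzBessel_sub_le {s k η : ℝ} (hs : 0 ≤ s)
    (hs' : s ≤ 1) (hk : 1 ≤ k) (hη : 0 < η) (hη' : η ≤ 1) (f : 𝓢(R3, ℂ)) :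
    ‖(schwartzBessel s (freeResolvent (k + η * I) (schwartzBessel s f)) -
        (((1 + k ^ 2) ^ s : ℝ) : ℂ) • freeResolvent (k + η * I) f).toLp 2‖ ≤
      2 * k ^ (2 * s - 2) * ‖f.toLp 2‖ := by
  have hz := im_sq_ne_zero (by linarith : 0 < k) hη
  have hJ := laplaceSymbol_hasTemperateGrowth s
  have hR := resolventSymbol_hasTemperateGrowth hz
  rw [schwartzBessel_freeResolvent_schwartzBessel_sub hz]
  refine norm_toLp_fourierMultiplierCLM_le
    ((hJ.mul (hR.mul hJ)).sub ((Function.HasTemperateGrowth.const _).mul hR)) (fun ξ => ?_) f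
  convert norm_rpow_sub_rpow_mul_inv_le hs hs' hk hη.le hη' (sq_nonneg ‖(2 * Real.pi) • ξ‖) using 2
  rw [Complex.ofReal_sub, ← laplaceSymbol_mul_self]
  simp only [Pi.sub_apply, Pi.mul_apply, resolventSymbol]
  ring

theorem mul_norm_toLp_bracketMul_freeResolvent_le {e δ k η : ℝ} (he : 0 < e) (he' : e ≤ 1 / 5)
    (hδ : 1 + e ≤ 2 * δ) (hk : 2 ≤ k) (hη : 0 < η) (hη' : η ≤ 1) (f : 𝓢(R3, ℂ)) :
    k * ‖(bracketMul (-δ) (freeResolvent (k + η * I) f)).toLp 2‖ ≤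
      41 / e * ‖(bracketMul δ f).toLp 2‖ := by
  have mono {p q : ℝ} (h : p ≤ q) (u : 𝓢(R3, ℂ)) :
      weightedInner (bracket p) u u ≤ weightedInner (bracket q) u u :=
    weightedInner_self_mono (bracket_hasTemperateGrowth p) (bracket_hasTemperateGrowth q)
      (bracket_mono h) u
  rw [← pow_le_pow_iff_left₀ (by positivity) (by positivity) two_ne_zero, mul_pow, mul_pow,
    norm_toLp_bracketMul_sq, norm_toLp_bracketMul_sq]
  set u := freeResolvent (k + η * I) f
  calc k ^ 2 * weightedInner (bracket (2 * -δ)) u u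
      ≤ k ^ 2 * weightedInner (bracket (-1 - e)) u u := by
        gcongr
        exact mono (by linarith) u
    _ ≤ (41 / e) ^ 2 * weightedInner (bracket (1 + e)) f f := by
        simpa only [u, helmholtz_freeResolvent (im_sq_ne_zero (by linarith : 0 < k) hη)] using
          sq_mul_weightedInner_le_helmholtz he he' hk hη.le hη' u
    _ ≤ (41 / e) ^ 2 * weightedInner (bracket (2 * δ)) f f := by
        gcongr
        exact mono hδ f

theorem one_add_sq_rpow_le {s k : ℝ} (hs : 0 ≤ s) (hs' : s ≤ 1) (hk : 1 ≤ k) :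
    (1 + k ^ 2) ^ s ≤ 2 * k ^ (2 * s) := by
  calc (1 + k ^ 2) ^ s ≤ (2 * k ^ 2) ^ s := by gcongr; nlinarith
    _ = 2 ^ s * k ^ (2 * s) := by
        rw [Real.mul_rpow two_pos.le (by positivity), Real.rpow_mul (by positivity), Real.rpow_two]
    _ ≤ 2 * k ^ (2 * s) := by
        gcongr
        exact Real.rpow_le_self_of_one_le one_le_two hs'

theorem norm_toLp_bracketMul_le_smul_add {δ c : ℝ} (hδ : δ ≤ 0) (hc : 0 ≤ c) (u v : 𝓢(R3, ℂ)) :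
    ‖(bracketMul δ v).toLp 2‖ ≤
      c * ‖(bracketMul δ u).toLp 2‖ + ‖(v - (c : ℂ) • u).toLp 2‖ := by
  have split : bracketMul δ v = (c : ℂ) • bracketMul δ u + bracketMul δ (v - (c : ℂ) • u) := by
    rw [← map_smul, ← map_add, add_sub_cancel]
  rw [split]
  refine (norm_toLp_add_le _ _).trans (add_le_add ?_ (norm_toLp_bracketMul_le hδ _))
  exact norm_toLp_le_mul_norm_toLp fun x => by
    rw [smul_apply, norm_smul, Complex.norm_of_nonneg hc]

theorem norm_toLp_bracketMul_schwartzBessel_freeResolvent_le {s e δ k η : ℝ} (hs : 0 ≤ s)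
    (hs' : s ≤ 1) (he : 0 < e) (he' : e ≤ 1 / 5) (hδ : 1 + e ≤ 2 * δ) (hk : 2 ≤ k) (hη : 0 < η)
    (hη' : η ≤ 1) (f : 𝓢(R3, ℂ)) :
    ‖(bracketMul (-δ) (schwartzBessel s (freeResolvent (k + η * I) (schwartzBessel s f)))).toLp 2‖
      ≤ (82 / e + 2) * k ^ (-(1 - 2 * s)) * ‖(bracketMul δ f).toLp 2‖ := by
  have hk0 : 0 < k := by linarith
  have frozen := mul_norm_toLp_bracketMul_freeResolvent_le he he' hδ hk hη hη' f
  have remainder := norm_toLp_schwartzBessel_freeResolvent_schwartzBessel_sub_le hs hs'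
    (by linarith : 1 ≤ k) hη hη' f
  have freezing := one_add_sq_rpow_le hs hs' (by linarith : 1 ≤ k)
  have hf : ‖f.toLp 2‖ ≤ ‖(bracketMul δ f).toLp 2‖ := by
    simpa only [bracketMul_neg_bracketMul] using
      norm_toLp_bracketMul_le (by linarith : -δ ≤ 0) (bracketMul δ f)
  have hc : 0 ≤ (1 + k ^ 2) ^ s := by positivity
  generalize schwartzBessel s (freeResolvent (k + η * I) (schwartzBessel s f)) = v,
    freeResolvent (k + η * I) f = u, (1 + k ^ 2) ^ s = c at *
  refine (norm_toLp_bracketMul_le_smul_add (by linarith) hc u v).trans ?_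
  have hN : 0 ≤ ‖(bracketMul δ f).toLp 2‖ := norm_nonneg _
  have hU : 0 ≤ ‖(bracketMul (-δ) u).toLp 2‖ := norm_nonneg _
  generalize ‖(bracketMul δ f).toLp 2‖ = N, ‖(bracketMul (-δ) u).toLp 2‖ = U,
    ‖(v - (c : ℂ) • u).toLp 2‖ = V at *
  calc c * U + V ≤ 2 * k ^ (2 * s) * (k⁻¹ * (41 / e * N)) + 2 * k ^ (2 * s - 2) * N := by
        gcongr
        · exact (le_inv_mul_iff₀ hk0).2 frozen
        · exact remainder.trans (by gcongr)
    _ ≤ 2 * k ^ (2 * s) * (k⁻¹ * (41 / e * N)) + 2 * k ^ (2 * s - 1) * N := by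
        gcongr <;> linarith
    _ = _ := by
        rw [show -(1 - 2 * s) = 2 * s - 1 by ring, Real.rpow_sub_one hk0.ne']
        ring

/-- The operator `⟨x⟩^(-δ) (I - Δ)^(s/2) (-Δ - z²)⁻¹ (I - Δ)^(s/2) ⟨x⟩^(-δ)`, that is, the
resolvent from `H^{-s}_δ` to `H^s_{-δ}` read on the `L²` sides. -/
def sandwichedResolvent (s δ : ℝ) (z : ℂ) : 𝓢(R3, ℂ) →L[ℂ] 𝓢(R3, ℂ) :=
  bracketMul (-δ) ∘L schwartzBessel s ∘L freeResolvent z ∘L schwartzBessel s ∘L bracketMul (-δ)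

theorem norm_toLp_sandwichedResolvent_le {s e δ k η : ℝ} (hs : 0 ≤ s) (hs' : s ≤ 1) (he : 0 < e)
    (he' : e ≤ 1 / 5) (hδ : 1 + e ≤ 2 * δ) (hk : 2 ≤ k) (hη : 0 < η) (hη' : η ≤ 1)
    (b : 𝓢(R3, ℂ)) :
    ‖(sandwichedResolvent s δ (k + η * I) b).toLp 2‖ ≤
      (82 / e + 2) * k ^ (-(1 - 2 * s)) * ‖b.toLp 2‖ := by
  have unweight : bracketMul δ (bracketMul (-δ) b) = b := by
    simpa only [neg_neg] using bracketMul_neg_bracketMul (-δ) b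
  simpa only [unweight] using! norm_toLp_bracketMul_schwartzBessel_freeResolvent_le hs hs' he he'
    hδ hk hη hη' (bracketMul (-δ) b)

end WeightedResolvent

section WeakLimits

variable {ι : Type*} {E : Type*} [NormedAddCommGroup E] [InnerProductSpace ℝ E]
  [FiniteDimensional ℝ E] [MeasurableSpace E] [BorelSpace E]

theorem norm_star_lp (g : Lp ℂ 2 (volume : Measure E)) : ‖star g‖ = ‖g‖ :=
  congrArg ENNReal.toReal AEEqFun.eLpNorm_star

theorem inner_star_toLp (g : Lp ℂ 2 (volume : Measure E)) (b : 𝓢(E, ℂ)) :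
    inner ℂ (star g) (b.toLp 2) = (g : 𝓢'(E, ℂ)) b := by
  rw [L2.inner_def, Lp.toTemperedDistribution_apply]
  refine integral_congr_ae ?_
  filter_upwards [b.coeFn_toLp 2, Lp.coeFn_star g] with x hb hg
  rw [hb, hg, Pi.star_apply, RCLike.inner_apply, starRingEnd_apply, star_star, smul_eq_mul]

theorem norm_lp_apply_le (g : Lp ℂ 2 (volume : Measure E)) (b : 𝓢(E, ℂ)) :
    ‖(g : 𝓢'(E, ℂ)) b‖ ≤ ‖g‖ * ‖b.toLp 2‖ := by
  rw [← inner_star_toLp, ← norm_star_lp g]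
  exact norm_inner_le_norm _ _

theorem lp_add_apply (g h : Lp ℂ 2 (volume : Measure E)) (b : 𝓢(E, ℂ)) :
    ((g + h : Lp ℂ 2 (volume : Measure E)) : 𝓢'(E, ℂ)) b =
      (g : 𝓢'(E, ℂ)) b + (h : 𝓢'(E, ℂ)) b :=
  DFunLike.congr_fun (map_add (Lp.toTemperedDistributionCLM ℂ volume 2) g h) b

theorem lp_smul_apply (c : ℂ) (g : Lp ℂ 2 (volume : Measure E)) (b : 𝓢(E, ℂ)) :
    ((c • g : Lp ℂ 2 (volume : Measure E)) : 𝓢'(E, ℂ)) b = c • (g : 𝓢'(E, ℂ)) b :=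
  DFunLike.congr_fun (map_smul (Lp.toTemperedDistributionCLM ℂ volume 2) c g) b

theorem lp_ext_schwartz {g h : Lp ℂ 2 (volume : Measure E)}
    (H : ∀ b : 𝓢(E, ℂ), (g : 𝓢'(E, ℂ)) b = (h : 𝓢'(E, ℂ)) b) : g = h :=
  LinearMap.ker_eq_bot.1 Lp.ker_toTemperedDistributionCLM_eq_bot
    (ContinuousLinearMap.ext H :
      Lp.toTemperedDistributionCLM ℂ volume 2 g = Lp.toTemperedDistributionCLM ℂ volume 2 h)

theorem exists_lp_apply_eq (l : 𝓢(E, ℂ) →ₗ[ℂ] ℂ) {M : ℝ} (hM : 0 ≤ M)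
    (hl : ∀ b, ‖l b‖ ≤ M * ‖b.toLp 2‖) :
    ∃ G : Lp ℂ 2 (volume : Measure E), ‖G‖ ≤ M ∧ ∀ b, (G : 𝓢'(E, ℂ)) b = l b := by
  let e : 𝓢(E, ℂ) →ₗ[ℂ] Lp ℂ 2 (volume : Measure E) :=
    (SchwartzMap.toLpCLM ℂ ℂ 2 volume).toLinearMap
  have dense : DenseRange e := SchwartzMap.denseRange_toLpCLM (by norm_num)
  refine ⟨star ((InnerProductSpace.toDual ℂ _).symm (l.extendOfNorm e)), ?_, fun b => ?_⟩
  · rw [norm_star_lp, LinearIsometryEquiv.norm_map]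
    exact LinearMap.opNorm_extendOfNorm_le dense hM hl
  · rw [← inner_star_toLp, star_star, InnerProductSpace.toDual_symm_apply]
    exact LinearMap.extendOfNorm_eq dense ⟨M, hl⟩ b

theorem exists_linearMap_tendsto {𝕜 V F : Type*} [NormedField 𝕜] [AddCommGroup V] [Module 𝕜 V]
    [NormedAddCommGroup F] [NormedSpace 𝕜 F] [ProperSpace F] (U : Ultrafilter ι)
    (l : ι → V →ₗ[𝕜] F) {p : V → ℝ} (hl : ∀ i v, ‖l i v‖ ≤ p v) :
    ∃ L : V →ₗ[𝕜] F, ∀ v, ‖L v‖ ≤ p v ∧ Tendsto (fun i => l i v) U (𝓝 (L v)) := by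
  have limit (v : V) : ∃ c ∈ Metric.closedBall (0 : F) (p v),
      Tendsto (fun i => l i v) U (𝓝 c) :=
    (isCompact_closedBall 0 (p v)).ultrafilter_le_nhds (U.map fun i => l i v)
      (tendsto_principal.2 (.of_forall fun i => mem_closedBall_zero_iff.2 (hl i v)))
  choose L L_mem L_lim using limit
  refine ⟨{ toFun := L, map_add' := fun v w => ?_, map_smul' := fun c v => ?_ },
    fun v => ⟨mem_closedBall_zero_iff.1 (L_mem v), L_lim v⟩⟩
  · refine tendsto_nhds_unique (L_lim (v + w)) ?_
    simpa only [map_add] using (L_lim v).add (L_lim w)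
  · refine tendsto_nhds_unique (L_lim (c • v)) ?_
    simpa only [map_smul, RingHom.id_apply] using (L_lim v).const_smul c

-- The limit operator is the transpose, for the bilinear pairing `∫ b g`, of a weak limit of `A`.
theorem exists_weak_limit_operator (U : Ultrafilter ι) (A : ι → 𝓢(E, ℂ) →ₗ[ℂ] 𝓢(E, ℂ)) {K : ℝ}
    (hK : 0 ≤ K) (hA : ∀ i b, ‖(A i b).toLp 2‖ ≤ K * ‖b.toLp 2‖) :
    ∃ S : Lp ℂ 2 (volume : Measure E) →L[ℂ] Lp ℂ 2 (volume : Measure E),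
      (∀ g, ‖S g‖ ≤ K * ‖g‖) ∧ ∀ (g : Lp ℂ 2 (volume : Measure E)) (b : 𝓢(E, ℂ)),
        Tendsto (fun i => (g : 𝓢'(E, ℂ)) (A i b)) U (𝓝 ((S g : 𝓢'(E, ℂ)) b)) := by
  have limit (g : Lp ℂ 2 (volume : Measure E)) : ∃ G : Lp ℂ 2 (volume : Measure E),
      ‖G‖ ≤ K * ‖g‖ ∧
        ∀ b, Tendsto (fun i => (g : 𝓢'(E, ℂ)) (A i b)) U (𝓝 ((G : 𝓢'(E, ℂ)) b)) := by
    have bound (i : ι) (b : 𝓢(E, ℂ)) : ‖(g : 𝓢'(E, ℂ)) (A i b)‖ ≤ K * ‖g‖ * ‖b.toLp 2‖ := by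
      refine (norm_lp_apply_le g (A i b)).trans ?_
      rw [mul_comm K, mul_assoc]
      gcongr
      exact hA i b
    obtain ⟨L, hL⟩ := exists_linearMap_tendsto U
      (fun i => (g : 𝓢'(E, ℂ)).toLinearMap ∘ₗ A i) bound
    obtain ⟨G, G_norm, G_apply⟩ := exists_lp_apply_eq L (by positivity) fun b => (hL b).1
    exact ⟨G, G_norm, fun b => (G_apply b).symm ▸ (hL b).2⟩
  choose S S_norm S_lim using limit
  refine ⟨LinearMap.mkContinuous
    { toFun := S, map_add' := fun g h => ?_, map_smul' := fun c g => ?_ } K S_norm, S_norm, S_lim⟩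
  · refine lp_ext_schwartz fun b => tendsto_nhds_unique (S_lim (g + h) b) ?_
    simpa only [lp_add_apply] using (S_lim g b).add (S_lim h b)
  · refine lp_ext_schwartz fun b => tendsto_nhds_unique (S_lim (c • g) b) ?_
    simpa only [lp_smul_apply, RingHom.id_apply] using (S_lim g b).const_smul c

end WeakLimits

section Duality

theorem fourierMultiplierCLM_apply_of_even {E F : Type*} [NormedAddCommGroup E]
    [InnerProductSpace ℝ E] [FiniteDimensional ℝ E] [MeasurableSpace E] [BorelSpace E]
    [NormedAddCommGroup F] [NormedSpace ℂ F] {g : E → ℂ} (hg : g.HasTemperateGrowth)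
    (even : ∀ ξ, g (-ξ) = g ξ) (u : 𝓢'(E, F)) (χ : 𝓢(E, ℂ)) :
    TemperedDistribution.fourierMultiplierCLM F g u χ =
      u (SchwartzMap.fourierMultiplierCLM ℂ g χ) := by
  rw [fourierMultiplierCLM_apply_apply, SchwartzMap.fourierMultiplierCLM_apply]
  congr 1
  ext x
  rw [SchwartzMap.fourierInv_coe, SchwartzMap.fourier_coe, Real.fourierInv_eq_fourier_comp_neg]
  refine congrArg (fun G : E → ℂ => 𝓕 G x) (funext fun ξ => ?_)
  rw [SchwartzMap.smulLeftCLM_apply_apply hg, SchwartzMap.smulLeftCLM_apply_apply hg, even,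
    SchwartzMap.fourierInv_coe, Real.fourierInv_eq_fourier_neg, SchwartzMap.fourier_coe]

theorem fracBessel_apply (s : ℝ) (u : 𝓢'(R3, ℂ)) (χ : 𝓢(R3, ℂ)) :
    fracBessel s u χ = u (schwartzBessel s χ) :=
  fourierMultiplierCLM_apply_of_even (laplaceSymbol_hasTemperateGrowth s)
    (fun ξ => by simp only [laplaceSymbol, bracketPow, smul_neg, norm_neg]) u χ

theorem weightedBessel_apply (s δ : ℝ) (u : 𝓢'(R3, ℂ)) (χ : 𝓢(R3, ℂ)) :
    weightedBessel s δ u χ = u (schwartzBessel s (bracketMul δ χ)) :=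
  fracBessel_apply s u (bracketMul δ χ)

theorem weightedBessel_fracBessel_smulLeftCLM (s δ : ℝ) (u : 𝓢'(R3, ℂ)) :
    weightedBessel s δ (fracBessel (-s) (smulLeftCLM ℂ (bracketPow (-δ)) u)) = u := by
  ext χ
  have cancel := schwartzBessel_schwartzBessel_neg (-s) (bracketMul δ χ)
  rw [neg_neg] at cancel
  rw [weightedBessel_apply, fracBessel_apply, cancel]
  exact congrArg u (bracketMul_neg_bracketMul δ χ)

namespace WeightedSobolev

variable {s δ : ℝ}

/-- The isometry `f ↦ ⟨x⟩^δ (I - Δ)^(s/2) f` from `H^s_δ` onto `L²`. -/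
def reprEquiv : WeightedSobolev s δ ≃ₗᵢ[ℂ] Lp ℂ 2 (volume : Measure R3) :=
  .ofSurjective ⟨reprHom, fun _ => rfl⟩ fun g =>
    ⟨⟨fracBessel (-s) (smulLeftCLM ℂ (bracketPow (-δ)) g), g,
      weightedBessel_fracBessel_smulLeftCLM s δ g⟩,
      lp_toDistribution_injective <|
        (repr_spec _).symm.trans (weightedBessel_fracBessel_smulLeftCLM s δ g)⟩

theorem toDistribution_eq (φ : WeightedSobolev s δ) :
    φ.toDistribution = fracBessel (-s) (smulLeftCLM ℂ (bracketPow (-δ)) (reprEquiv φ)) :=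
  weightedBessel_injective s δ <|
    (repr_spec φ).trans (weightedBessel_fracBessel_smulLeftCLM s δ _).symm

theorem toDistribution_apply (φ : WeightedSobolev s δ) (χ : 𝓢(R3, ℂ)) :
    φ.toDistribution χ = (reprEquiv φ : 𝓢'(R3, ℂ)) (bracketMul (-δ) (schwartzBessel (-s) χ)) := by
  rw [toDistribution_eq, fracBessel_apply]
  rfl

theorem toDistribution_reprEquiv_symm_schwartz (b : 𝓢(R3, ℂ)) :
    (reprEquiv.symm (b.toLp 2) : WeightedSobolev s δ).toDistribution =
      schwartzBessel (-s) (bracketMul (-δ) b) := by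
  have weight : smulLeftCLM ℂ (bracketPow (-δ)) (b : 𝓢'(R3, ℂ)) = bracketMul (-δ) b := by
    ext χ
    change (b : 𝓢'(R3, ℂ)) (bracketMul (-δ) χ) = _
    simp only [SchwartzMap.toTemperedDistributionCLM_apply_apply, bracketMul_apply, smul_eq_mul,
      mul_assoc, mul_left_comm]
  rw [toDistribution_eq, LinearIsometryEquiv.apply_symm_apply, Lp.toTemperedDistribution_toLp_eq,
    weight]
  exact fourierMultiplierCLM_toTemperedDistributionCLM_eq (laplaceSymbol_hasTemperateGrowth _) _

theorem denseRange_reprEquiv_symm_schwartz :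
    DenseRange fun b : 𝓢(R3, ℂ) => (reprEquiv.symm (b.toLp 2) : WeightedSobolev s δ) :=
  reprEquiv.symm.surjective.denseRange.comp (SchwartzMap.denseRange_toLpCLM (by norm_num))
    reprEquiv.symm.continuous

end WeightedSobolev

theorem isGivenBy_schwartz (b : 𝓢(R3, ℂ)) : IsGivenBy b b := by
  refine fun ψ => ⟨?_, SchwartzMap.toTemperedDistributionCLM_apply_apply volume b ψ⟩
  refine (SchwartzMap.smulLeftCLM ℂ b ψ).integrable.congr (.of_forall fun x => ?_)
  rw [SchwartzMap.smulLeftCLM_apply_apply b.hasTemperateGrowth, smul_eq_mul, mul_comm]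

end Duality

section LimitingAbsorption

variable {s δ e k : ℝ}

theorem toDistribution_freeResolvent (φ : WeightedSobolev (-s) δ) (z : ℂ) (χ : 𝓢(R3, ℂ)) :
    φ.toDistribution (freeResolvent z χ) = (φ.reprEquiv : 𝓢'(R3, ℂ))
      (sandwichedResolvent s δ z (bracketMul δ (schwartzBessel (-s) χ))) := by
  rw [φ.toDistribution_apply, neg_neg]
  simp only [sandwichedResolvent, ContinuousLinearMap.comp_apply, bracketMul_neg_bracketMul,
    schwartzBessel_schwartzBessel_neg]

/-- The spectral parameters `k + i/(n+1)`, approaching the real axis from above. -/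
def spectralParam (k : ℝ) (n : ℕ) : ℂ := k + ((1 / (n + 1) : ℝ) : ℂ) * Complex.I

theorem exists_limitingAbsorption (hs : 0 ≤ s) (hs' : s ≤ 1) (he : 0 < e) (he' : e ≤ 1 / 5)
    (hδ : 1 + e ≤ 2 * δ) (hk : 2 ≤ k) :
    ∃ T : WeightedSobolev (-s) δ →L[ℂ] WeightedSobolev s (-δ),
      (∀ φ, ‖T φ‖ ≤ (82 / e + 2) * k ^ (-(1 - 2 * s)) * ‖φ‖) ∧
      ∀ φ χ, Tendsto (fun n => φ.toDistribution (freeResolvent (spectralParam k n) χ))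
        (hyperfilter ℕ) (𝓝 ((T φ).toDistribution χ)) := by
  obtain ⟨S, S_norm, S_lim⟩ := exists_weak_limit_operator (hyperfilter ℕ)
    (fun n => (sandwichedResolvent s δ (spectralParam k n)).toLinearMap)
    (by positivity : 0 ≤ (82 / e + 2) * k ^ (-(1 - 2 * s)))
    (fun n => norm_toLp_sandwichedResolvent_le hs hs' he he' hδ hk Nat.one_div_pos_of_nat
      (Nat.one_div_le_one_div n.zero_le |>.trans_eq (by simp)))
  let domain : WeightedSobolev (-s) δ ≃ₗᵢ[ℂ] _ := WeightedSobolev.reprEquiv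
  let target : WeightedSobolev s (-δ) ≃ₗᵢ[ℂ] _ := WeightedSobolev.reprEquiv
  let T : WeightedSobolev (-s) δ →L[ℂ] WeightedSobolev s (-δ) :=
    (target.symm : _ →L[ℂ] WeightedSobolev s (-δ)) ∘L S ∘L
      (domain : WeightedSobolev (-s) δ →L[ℂ] _)
  refine ⟨T, fun φ => ?_, fun φ χ => ?_⟩
  · calc ‖T φ‖ = ‖S (domain φ)‖ := target.symm.norm_map _
      _ ≤ (82 / e + 2) * k ^ (-(1 - 2 * s)) * ‖domain φ‖ := S_norm _
      _ = _ := by rw [domain.norm_map]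
  · have repr_T : (T φ).reprEquiv = S φ.reprEquiv := target.apply_symm_apply _
    simp only [toDistribution_freeResolvent]
    rw [(T φ).toDistribution_apply, repr_T, neg_neg]
    exact S_lim _ _

end LimitingAbsorption

section ResolventKernel

variable {k : ℝ} {f : R3 → ℂ}

@[fun_prop]
theorem measurable_outgoingProfile (z : ℂ) : Measurable (outgoingProfile z) := by
  unfold outgoingProfile
  fun_prop

theorem norm_outgoingProfile_mul_le {z : ℂ} (hz : 0 ≤ z.im) (x y : R3) (c : ℂ) :
    ‖outgoingProfile z ‖y - x‖ * c‖ ≤ (4 * Real.pi)⁻¹ * (‖x - y‖⁻¹ * ‖c‖) := by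
  rw [norm_mul, ← mul_assoc, norm_sub_rev x y]
  gcongr
  exact norm_outgoingProfile_le hz (norm_nonneg _)

theorem exists_norm_integral_outgoingProfile_mul_le (χ : 𝓢(R3, ℂ)) : ∃ C, ∀ z : ℂ, 0 ≤ z.im →
    ∀ y : R3, ‖∫ x, outgoingProfile z ‖y - x‖ * χ x‖ ≤ C * bracket (-1) y := by
  obtain ⟨C, -, hC⟩ := exists_integral_inv_norm_mul_schwartz_le χ
  refine ⟨(4 * Real.pi)⁻¹ * C, fun z hz y => ?_⟩
  refine (norm_integral_le_of_norm_le ((hC y).1.const_mul (4 * Real.pi)⁻¹)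
    (.of_forall fun x => norm_outgoingProfile_mul_le hz x y (χ x))).trans ?_
  rw [integral_const_mul, mul_assoc]
  gcongr
  exact (hC y).2

theorem spectralParam_im (k : ℝ) (n : ℕ) : (spectralParam k n).im = 1 / (n + 1) := by
  rw [spectralParam, Complex.add_im, Complex.ofReal_im, Complex.im_ofReal_mul, Complex.I_im,
    zero_add, mul_one]

theorem spectralParam_im_nonneg (k : ℝ) (n : ℕ) : 0 ≤ (spectralParam k n).im := by
  rw [spectralParam_im]
  positivity

theorem tendsto_spectralParam (k : ℝ) : Tendsto (spectralParam k) atTop (𝓝 k) := by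
  have h : Tendsto (fun n : ℕ => ((1 / (n + 1) : ℝ) : ℂ)) atTop (𝓝 (0 : ℝ)) :=
    (Complex.continuous_ofReal.tendsto 0).comp tendsto_one_div_add_atTop_nhds_zero_nat
  simpa only [Complex.ofReal_zero, zero_mul, add_zero] using!
    (h.mul_const Complex.I).const_add (k : ℂ)

theorem freeResolvent_spectralParam_apply (hk : 0 < k) (n : ℕ) (χ : 𝓢(R3, ℂ)) (y : R3) :
    freeResolvent (spectralParam k n) χ y =
      ∫ x, outgoingProfile (spectralParam k n) ‖y - x‖ * χ x :=
  freeResolvent_apply hk Nat.one_div_pos_of_nat χ y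

theorem tendsto_freeResolvent_spectralParam_apply (hk : 0 < k) (χ : 𝓢(R3, ℂ)) (y : R3) :
    Tendsto (fun n => freeResolvent (spectralParam k n) χ y) atTop
      (𝓝 (resolventIntegral k χ y)) := by
  obtain ⟨C, -, hC⟩ := exists_integral_inv_norm_mul_schwartz_le χ
  have := χ.continuous.measurable
  have hcont (r : ℝ) : Continuous fun z => outgoingProfile z r := by
    unfold outgoingProfile
    fun_prop
  simp only [freeResolvent_spectralParam_apply hk]
  exact tendsto_integral_of_dominated_convergence _
    (fun n => Measurable.aestronglyMeasurable (by fun_prop))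
    ((hC y).1.const_mul (4 * Real.pi)⁻¹)
    (fun n => .of_forall fun x =>
      norm_outgoingProfile_mul_le (spectralParam_im_nonneg k n) x y (χ x))
    (.of_forall fun x => (((hcont _).tendsto _).comp (tendsto_spectralParam k)).mul_const _)

theorem tendsto_integral_freeResolvent_mul (hk : 0 < k) (hf : AEStronglyMeasurable f)
    (hf' : Integrable fun y => bracket (-1) y * ‖f y‖) (χ : 𝓢(R3, ℂ)) :
    Tendsto (fun n => ∫ y, freeResolvent (spectralParam k n) χ y * f y) atTop
      (𝓝 (∫ y, resolventIntegral k χ y * f y)) := by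
  obtain ⟨C, hC⟩ := exists_norm_integral_outgoingProfile_mul_le χ
  refine tendsto_integral_of_dominated_convergence _
    (fun n => (freeResolvent (spectralParam k n) χ).continuous.aestronglyMeasurable.mul hf)
    (hf'.const_mul C) (fun n => .of_forall fun y => ?_)
    (.of_forall fun y => (tendsto_freeResolvent_spectralParam_apply hk χ y).mul_const _)
  rw [norm_mul, ← mul_assoc, freeResolvent_spectralParam_apply hk]
  gcongr
  exact hC _ (spectralParam_im_nonneg k n) y

theorem norm_outgoingKernel (k : ℝ) (x y : R3) :
    ‖outgoingKernel k x y‖ = (4 * Real.pi * ‖x - y‖)⁻¹ := by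
  have phase : Complex.I * k * ‖x - y‖ = ((k * ‖x - y‖ : ℝ) : ℂ) * Complex.I := by
    push_cast
    ring
  rw [outgoingKernel, norm_div, phase, Complex.norm_exp_ofReal_mul_I, one_div]
  simp [abs_of_pos Real.pi_pos]

theorem measurable_outgoingKernel (k : ℝ) (x : R3) : Measurable (outgoingKernel k x) := by
  unfold outgoingKernel
  fun_prop

theorem bracket_neg_one_le_mul_norm_outgoingKernel (k : ℝ) {x y : R3} (h : x ≠ y) :
    bracket (-1) y ≤ 4 * Real.pi * (‖x‖ + 1) * ‖outgoingKernel k x y‖ := by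
  have hxy : 0 < ‖x - y‖ := norm_pos_iff.2 (sub_ne_zero.2 h)
  have hy : ‖y‖ ≤ bracket 1 y := by
    rw [bracket_one_eq_sqrt]
    exact Real.le_sqrt_of_sq_le (by linarith)
  have hy' : 1 ≤ bracket 1 y := by
    rw [bracket_one_eq_sqrt, Real.one_le_sqrt]
    linarith [sq_nonneg ‖y‖]
  have distance_le : ‖x - y‖ ≤ (‖x‖ + 1) * bracket 1 y := by
    nlinarith [norm_sub_le x y, norm_nonneg x]
  rw [norm_outgoingKernel, mul_inv, mul_mul_mul_comm, mul_inv_cancel₀ (by positivity), one_mul,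
    bracket_neg, ← div_eq_mul_inv, inv_le_comm₀ (bracket_pos 1 y) (by positivity), inv_div]
  exact (div_le_iff₀' (by positivity)).2 distance_le

theorem ae_ne_point (x : R3) : ∀ᵐ y : R3, x ≠ y := by
  simp [ae_iff]

theorem ResolventIntegrable.aestronglyMeasurable (h : ResolventIntegrable k f) :
    AEStronglyMeasurable f := by
  obtain ⟨x, hx⟩ := h.exists
  refine ((measurable_outgoingKernel k x).inv.aestronglyMeasurable.mul hx.1).congr ?_
  filter_upwards [ae_ne_point x] with y hy
  have : outgoingKernel k x y ≠ 0 := by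
    have := norm_pos_iff.2 (sub_ne_zero.2 hy)
    rw [← norm_pos_iff, norm_outgoingKernel]
    positivity
  exact inv_mul_cancel_left₀ this (f y)

theorem ResolventIntegrable.integrable_bracket_mul (h : ResolventIntegrable k f) :
    Integrable fun y => bracket (-1) y * ‖f y‖ := by
  obtain ⟨x, hx⟩ := h.exists
  refine (hx.norm.const_mul (4 * Real.pi * (‖x‖ + 1))).mono'
    ((continuous_bracket (-1)).aestronglyMeasurable.mul h.aestronglyMeasurable.norm) ?_
  filter_upwards [ae_ne_point x] with y hy
  rw [norm_mul, norm_mul, norm_norm, Real.norm_of_nonneg (bracket_pos _ _).le, ← mul_assoc]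
  gcongr
  exact bracket_neg_one_le_mul_norm_outgoingKernel k hy

theorem integrable_outgoingKernel_mul_schwartz (k : ℝ) (χ : 𝓢(R3, ℂ)) (y : R3) :
    Integrable fun x => outgoingKernel k y x * χ x := by
  obtain ⟨C, -, hC⟩ := exists_integral_inv_norm_mul_schwartz_le χ
  exact ((hC y).1.const_mul (4 * Real.pi)⁻¹).mono'
    ((measurable_outgoingKernel k y).mul χ.continuous.measurable).aestronglyMeasurable
    (.of_forall fun x => norm_outgoingProfile_mul_le (z := k) (Complex.ofReal_im k).ge x y (χ x))

theorem integrable_prod_outgoingKernel_mul (k : ℝ) (hf : AEStronglyMeasurable f)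
    (hf' : Integrable fun y => bracket (-1) y * ‖f y‖) (χ : 𝓢(R3, ℂ)) :
    Integrable (fun p : R3 × R3 => outgoingKernel k p.1 p.2 * χ p.2 * f p.1)
      (volume.prod volume) := by
  obtain ⟨C, -, hC⟩ := exists_integral_inv_norm_mul_schwartz_le χ
  have measurable_kernel : Measurable fun p : R3 × R3 => outgoingKernel k p.1 p.2 * χ p.2 := by
    have := χ.continuous.measurable
    unfold outgoingKernel
    fun_prop
  have measurable_prod := measurable_kernel.aestronglyMeasurable (μ := volume.prod volume) |>.mul
    hf.comp_fst
  refine (integrable_prod_iff measurable_prod).2 ⟨.of_forall fun y =>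
    (integrable_outgoingKernel_mul_schwartz k χ y).mul_const (f y), ?_⟩
  refine (hf'.const_mul ((4 * Real.pi)⁻¹ * C)).mono' measurable_prod.norm.integral_prod_right'
    (.of_forall fun y => ?_)
  rw [Real.norm_of_nonneg (integral_nonneg fun _ => norm_nonneg _)]
  calc ∫ x, ‖outgoingKernel k y x * χ x * f y‖
      = (4 * Real.pi)⁻¹ * (∫ x, ‖x - y‖⁻¹ * ‖χ x‖) * ‖f y‖ := by
        rw [← integral_const_mul, ← integral_mul_const]
        simp only [norm_mul, norm_outgoingKernel, mul_inv, norm_sub_rev y, mul_assoc]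
    _ ≤ (4 * Real.pi)⁻¹ * (C * bracket (-1) y) * ‖f y‖ := by
        gcongr
        exact (hC y).2
    _ = _ := by ring

theorem integral_mul_resolventIntegral (k : ℝ) (hf : AEStronglyMeasurable f)
    (hf' : Integrable fun y => bracket (-1) y * ‖f y‖) (χ : 𝓢(R3, ℂ)) :
    Integrable (fun x => χ x * resolventIntegral k f x) ∧
      ∫ x, χ x * resolventIntegral k f x = ∫ y, resolventIntegral k χ y * f y := by
  have integrable_prod := integrable_prod_outgoingKernel_mul k hf hf' χ
  have fiber (x : R3) : χ x * resolventIntegral k f x =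
      ∫ y, outgoingKernel k y x * χ x * f y := by
    rw [resolventIntegral, ← integral_const_mul]
    congr with y
    rw [outgoingKernel, outgoingKernel, norm_sub_rev]
    ring
  simp only [fiber]
  simp only [resolventIntegral, ← integral_mul_const]
  exact ⟨integrable_prod.integral_prod_right,
    (integral_integral_swap (f := fun y x => outgoingKernel k y x * χ x * f y)
      integrable_prod).symm⟩

end ResolventKernel

section Extension

variable {s δ t γ k : ℝ}

theorem extendsResolvent_of_tendsto (hk : 0 < k)
    {T : WeightedSobolev s δ →L[ℂ] WeightedSobolev t γ}
    (hT : ∀ φ χ, Tendsto (fun n => φ.toDistribution (freeResolvent (spectralParam k n) χ))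
      (hyperfilter ℕ) (𝓝 ((T φ).toDistribution χ))) : ExtendsResolvent k T := by
  intro φ f hφ hf χ
  have measurable_f := hf.aestronglyMeasurable
  have integrable_f := hf.integrable_bracket_mul
  obtain ⟨integrable, symmetric⟩ := integral_mul_resolventIntegral k measurable_f integrable_f χ
  refine ⟨integrable, tendsto_nhds_unique (hT φ χ) ?_⟩
  rw [symmetric]
  simp only [fun n => (hφ (freeResolvent (spectralParam k n) χ)).2]
  exact (tendsto_integral_freeResolvent_mul hk measurable_f integrable_f χ).mono_left
    Nat.hyperfilter_le_atTop

theorem ExtendsResolvent.unique {T T' : WeightedSobolev s δ →L[ℂ] WeightedSobolev t γ}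
    (hT : ExtendsResolvent k T) (hT' : ExtendsResolvent k T') : T = T' := by
  refine DFunLike.coe_injective (WeightedSobolev.denseRange_reprEquiv_symm_schwartz.equalizer
    T.continuous T'.continuous (funext fun b => WeightedSobolev.toDistribution_injective ?_))
  have given := WeightedSobolev.toDistribution_reprEquiv_symm_schwartz (s := s) (δ := δ) b ▸
    isGivenBy_schwartz (schwartzBessel (-s) (bracketMul (-δ) b))
  have integrable : ResolventIntegrable k (schwartzBessel (-s) (bracketMul (-δ) b)) :=
    .of_forall (integrable_outgoingKernel_mul_schwartz k _)
  ext χ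
  exact (hT _ _ given integrable χ).2.trans (hT' _ _ given integrable χ).2.symm

end Extension

theorem lemma2p3_general (s ε : ℝ) (hs : 0 ≤ s) (hs' : s ≤ 1) (hε : 0 < ε) :
    ∃ C : ℝ, 0 < C ∧ ∀ k : ℝ, 2 ≤ k →
      ∃ R : WeightedSobolev (-s) (1 / 2 + ε) →L[ℂ] WeightedSobolev s (-1 / 2 - ε),
        ExtendsResolvent k R ∧
        (∀ R' : WeightedSobolev (-s) (1 / 2 + ε) →L[ℂ] WeightedSobolev s (-1 / 2 - ε),
          ExtendsResolvent k R' → R' = R) ∧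
        ∀ φ : WeightedSobolev (-s) (1 / 2 + ε), ‖R φ‖ ≤ C * k ^ (-(1 - 2 * s)) * ‖φ‖ := by
  obtain ⟨e, he, he', heε⟩ : ∃ e : ℝ, 0 < e ∧ e ≤ 1 / 5 ∧ e ≤ 2 * ε :=
    ⟨min (1 / 5) (2 * ε), by positivity, min_le_left _ _, min_le_right _ _⟩
  refine ⟨82 / e + 2, by positivity, fun k hk => ?_⟩
  rw [show -1 / 2 - ε = -(1 / 2 + ε) by ring]
  obtain ⟨R, R_norm, R_lim⟩ := exists_limitingAbsorption hs hs' he he'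
    (by linarith : 1 + e ≤ 2 * (1 / 2 + ε)) hk
  have extends_R := extendsResolvent_of_tendsto (by linarith) R_lim
  exact ⟨R, extends_R, fun R' extends_R' => extends_R'.unique extends_R, R_norm⟩

end

/-- For `0 < s < 1/2` and `ε > 0` there is a constant `C`, depending on `s` and `ε` only, such that
for every `k > 2` the integral operator `R_k` has exactly one bounded extension
`H^{-s}_{1/2+ε} → H^s_{-1/2-ε}`, and `‖R_k φ‖ ≤ C k^{-(1-2s)} ‖φ‖` for all `φ ∈ H^{-s}_{1/2+ε}`. -/
theorem lemma2p3 (s ε : ℝ) (hs : 0 < s) (hs' : s < 1 / 2) (hε : 0 < ε) :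
    ∃ C : ℝ, 0 < C ∧ ∀ k : ℝ, 2 < k →
      ∃ R : WeightedSobolev (-s) (1 / 2 + ε) →L[ℂ] WeightedSobolev s (-1 / 2 - ε),
        ExtendsResolvent k R ∧
        (∀ R' : WeightedSobolev (-s) (1 / 2 + ε) →L[ℂ] WeightedSobolev s (-1 / 2 - ε),
          ExtendsResolvent k R' → R' = R) ∧
        ∀ φ : WeightedSobolev (-s) (1 / 2 + ε), ‖R φ‖ ≤ C * k ^ (-(1 - 2 * s)) * ‖φ‖ := by
  obtain ⟨C, C_pos, bounds⟩ := lemma2p3_general s ε hs.le (by linarith) hε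
  exact ⟨C, C_pos, fun k hk => bounds k hk.le⟩
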